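/- All manifolds and maps are smooth. Let $Y$ be an oriented $3$-manifold embedded in an oriented $5$-manifold $W$, let $\gamma\subset Y$ be an oriented embedded circle, and let $\Delta\subset W$ be an embedded closed disk with $\partial\Delta=\gamma=\Delta\cap Y$ and $T_p\Delta\cap T_pY=T_p\gamma$ for every $p\in\gamma$. Write $N_Y(\gamma)=TY|_\gamma/T\gamma$ and $N_W(\Delta)=TW|_\Delta/T\Delta$ for the normal bundles, so that $N_Y(\gamma)$ is a subbundle of $N_W(\Delta)|_\gamma$; the bundle $N_Y(\gamma)$ is oriented by the orientations of $\gamma$ and $Y$. A framing of $N_Y(\gamma)$ is a smooth orientation-preserving trivialization, i.e. a pair $(v_1,v_2)$ of smooth sections of $N_Y(\gamma)$ forming a positive basis of every fibre; framings are considered up to homotopy through framings. An integer $k$ acts on framings by rotating $k$ times along $\gamma$: with $\gamma$ parametrized, compatibly with its orientation, by an angle $\theta\in\mathbb{R}/2\pi\mathbb{Z}$, $$k\cdot(v_1,v_2)=(\cos(k\theta)\,v_1+\sin(k\theta)\,v_2,\;-\sin(k\theta)\,v_1+\cos(k\theta)\,v_2).$$ A framing $\phi$ of $N_Y(\gamma)$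 is called $\Delta$-admissible if there is a smooth $2$-dimensional subbundle $B\subset N_W(\Delta)$ with a smooth framing (a pair of smooth sections forming a basis of every fibre of $B$) whose restriction to $\gamma$ is $\phi$. Then the action of $\mathbb{Z}$ on the set of homotopy classes of framings of $N_Y(\gamma)$ is free and transitive. Moreover, for every framing $\phi$ of $N_Y(\gamma)$, one of the following holds: the $\Delta$-admissible framings are exactly the framings homotopic to $k\cdot\phi$ for some even integer $k$, or they are exactly the framings homotopic to $k\cdot\phi$ for some odd integer $k$. -/

import Mathlib

open Manifold Topology
open scoped ContDiff

namespace AmbientSurgery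

noncomputable section

/-- An orientation of a manifold `M` with tangent spaces of dimension `n`: an orientation of each
tangent space, such that near every point there is a continuous local frame which is
positive at each point. -/
structure ManifoldOrientation {n : ℕ} {H : Type*} [TopologicalSpace H]
    (I : ModelWithCorners ℝ (EuclideanSpace ℝ (Fin n)) H)
    (M : Type*) [TopologicalSpace M] [ChartedSpace H M] [IsManifold I 1 M] where
  orientationAt : ∀ x : M, Orientation ℝ (TangentSpace I x) (Fin n)
  exists_oriented_frame : ∀ x₀ : M, ∃ U ∈ 𝓝 x₀, ∃ X : Fin n → ∀ x : M, TangentSpace I x,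
    (∀ i, ContinuousOn (fun x => (⟨x, X i x⟩ : TangentBundle I M)) U) ∧
    ∀ x ∈ U, ∃ b : Module.Basis (Fin n) ℝ (TangentSpace I x),
      (∀ i, b i = X i x) ∧ b.orientation = orientationAt x

section Curve

variable {H : Type*} [TopologicalSpace H]
  {J : ModelWithCorners ℝ (EuclideanSpace ℝ (Fin 3)) H}
  {Y : Type*} [TopologicalSpace Y] [ChartedSpace H Y]

variable (J) in
/-- The velocity at `z` of a closed curve, i.e. the derivative of `t ↦ γ (z * exp (i t))` at `0`.
It spans the tangent line of `γ` and points in the direction of its orientation. -/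
def velocity (γ : Circle → Y) (z : Circle) : TangentSpace J (γ z) :=
  mfderiv 𝓘(ℝ, ℝ) J (fun t : ℝ => γ (z * Circle.exp t)) 0 (1 : ℝ)

variable (J) in
/-- The tangent line of the curve `γ` at `γ z`. -/
abbrev tangentLine (γ : Circle → Y) (z : Circle) : Submodule ℝ (TangentSpace J (γ z)) :=
  Submodule.span ℝ {velocity J γ z}

variable (J) in
/-- The fibre at `γ z` of the normal bundle `N_Y(γ) = TY|_γ / Tγ`. -/
abbrev CurveNormal (γ : Circle → Y) (z : Circle) : Type _ :=
  TangentSpace J (γ z) ⧸ tangentLine J γ z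

variable [IsManifold J 1 Y]

/-- A section of `N_Y(γ)` is smooth if it is the class of a smooth vector field along `γ`. -/
def IsSmoothCurveNormalSection (γ : Circle → Y) (s : ∀ z, CurveNormal J γ z) : Prop :=
  ∃ v : ∀ z, TangentSpace J (γ z),
    ContMDiff (𝓡 1) J.tangent ∞ (fun z => (⟨γ z, v z⟩ : TangentBundle J Y)) ∧
    ∀ z, (tangentLine J γ z).mkQ (v z) = s z

/-- A pair of normal vectors is a positive basis of the fibre of `N_Y(γ)` at `γ z`, for the
orientation induced by those of `γ` and `Y`: the velocity of `γ` followed by representatives of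
the two normal vectors is a positive basis of the tangent space of `Y`. -/
def IsPositiveNormalBasis (o : ManifoldOrientation J Y) (γ : Circle → Y) (z : Circle)
    (n : Fin 2 → CurveNormal J γ z) : Prop :=
  ∃ v : Fin 2 → TangentSpace J (γ z), (∀ i, (tangentLine J γ z).mkQ (v i) = n i) ∧
    ∃ b : Module.Basis (Fin 3) ℝ (TangentSpace J (γ z)),
      ⇑b = ![velocity J γ z, v 0, v 1] ∧ b.orientation = o.orientationAt (γ z)

/-- A framing of `N_Y(γ)`: a smooth, orientation-preserving trivialization, given by the pair of
sections that corresponds to the standard basis of `ℝ²`. -/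
@[ext]
structure Framing (o : ManifoldOrientation J Y) (γ : Circle → Y) where
  vec : Fin 2 → ∀ z, CurveNormal J γ z
  smooth : ∀ i, IsSmoothCurveNormalSection γ (vec i)
  positive : ∀ z, IsPositiveNormalBasis o γ z (fun i => vec i z)

/-- Homotopy through framings: a family of framings, indexed by `[0, 1]`, whose two
sections are the classes of vector fields along `γ` that depend jointly continuously on the
parameter and the point. -/
def Homotopic {o : ManifoldOrientation J Y} {γ : Circle → Y} (φ ψ : Framing o γ) : Prop :=
  ∃ Φ : unitInterval → Framing o γ, Φ 0 = φ ∧ Φ 1 = ψ ∧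
    ∀ i, ∃ v : unitInterval → ∀ z, TangentSpace J (γ z),
      Continuous (fun p : unitInterval × Circle =>
        (⟨γ p.2, v p.1 p.2⟩ : TangentBundle J Y)) ∧
      ∀ t z, (tangentLine J γ z).mkQ (v t z) = (Φ t).vec i z

/-- A linear combination of continuous vector fields along a map is continuous. -/
lemma continuous_comb {X : Type*} [TopologicalSpace X] {g : X → Y}
    {v w : ∀ x, TangentSpace J (g x)} {a b : X → ℝ} (ha : Continuous a) (hb : Continuous b)
    (hv : Continuous (fun x => (⟨g x, v x⟩ : TangentBundle J Y)))
    (hw : Continuous (fun x => (⟨g x, w x⟩ : TangentBundle J Y))) :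
    Continuous (fun x => (⟨g x, a x • v x + b x • w x⟩ : TangentBundle J Y)) := by
  rw [continuous_iff_continuousAt]
  intro x
  have h1 := (FiberBundle.continuousAt_totalSpace _ _).1 (hv.continuousAt (x := x))
  have h2 := (FiberBundle.continuousAt_totalSpace _ _).1 (hw.continuousAt (x := x))
  rw [FiberBundle.continuousAt_totalSpace]
  refine ⟨h1.1, ?_⟩
  refine ((ha.continuousAt.smul h1.2).add (hb.continuousAt.smul h2.2)).congr ?_
  have hmem : ∀ᶠ y in 𝓝 x, g y ∈ (trivializationAt (EuclideanSpace ℝ (Fin 3))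
      (TangentSpace J : Y → Type _) (g x)).baseSet :=
    h1.1.tendsto.eventually ((Bundle.Trivialization.open_baseSet _).mem_nhds
      (FiberBundle.mem_baseSet_trivializationAt' (F := EuclideanSpace ℝ (Fin 3))
        (E := (TangentSpace J : Y → Type _)) (g x)))
  filter_upwards [hmem] with y hy
  have hl := (trivializationAt (EuclideanSpace ℝ (Fin 3))
      (TangentSpace J : Y → Type _) (g x)).linear ℝ hy
  simp only [hl.map_add, hl.map_smul, Pi.add_apply, Pi.smul_apply']

/-- A linear combination of smooth vector fields along a curve is smooth. -/
lemma contMDiff_comb {g : Circle → Y}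
    {v w : ∀ x, TangentSpace J (g x)} {a b : Circle → ℝ}
    (ha : ContMDiff (𝓡 1) 𝓘(ℝ, ℝ) ∞ a) (hb : ContMDiff (𝓡 1) 𝓘(ℝ, ℝ) ∞ b)
    (hv : ContMDiff (𝓡 1) J.tangent ∞ (fun x => (⟨g x, v x⟩ : TangentBundle J Y)))
    (hw : ContMDiff (𝓡 1) J.tangent ∞ (fun x => (⟨g x, w x⟩ : TangentBundle J Y))) :
    ContMDiff (𝓡 1) J.tangent ∞
      (fun x => (⟨g x, a x • v x + b x • w x⟩ : TangentBundle J Y)) := by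
  intro x
  have h1 := Bundle.contMDiffAt_totalSpace.1 (hv x)
  have h2 := Bundle.contMDiffAt_totalSpace.1 (hw x)
  refine Bundle.contMDiffAt_totalSpace.2 ⟨h1.1, ?_⟩
  refine (((ha x).smul h1.2).add ((hb x).smul h2.2)).congr_of_eventuallyEq ?_
  have hmem : ∀ᶠ y in 𝓝 x, g y ∈ (trivializationAt (EuclideanSpace ℝ (Fin 3))
      (TangentSpace J : Y → Type _) (g x)).baseSet :=
    h1.1.continuousAt.tendsto.eventually ((Bundle.Trivialization.open_baseSet _).mem_nhds
      (FiberBundle.mem_baseSet_trivializationAt' (F := EuclideanSpace ℝ (Fin 3))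
        (E := (TangentSpace J : Y → Type _)) (g x)))
  filter_upwards [hmem] with y hy
  have hl := (trivializationAt (EuclideanSpace ℝ (Fin 3))
      (TangentSpace J : Y → Type _) (g x)).linear ℝ hy
  simp only [hl.map_add, hl.map_smul, Pi.add_apply, Pi.smul_apply']

variable {o : ManifoldOrientation J Y} {γ : Circle → Y}

lemma Homotopic.refl (φ : Framing o γ) : Homotopic φ φ := by
  refine ⟨fun _ => φ, rfl, rfl, fun i => ?_⟩
  obtain ⟨v, hv, h⟩ := φ.smooth i
  exact ⟨fun _ => v, hv.continuous.comp continuous_snd, fun _ => h⟩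

lemma Homotopic.symm {φ ψ : Framing o γ} (h : Homotopic φ ψ) : Homotopic ψ φ := by
  obtain ⟨Φ, h0, h1, h⟩ := h
  refine ⟨fun t => Φ (unitInterval.symm t), by simpa using h1, by simpa using h0, fun i => ?_⟩
  obtain ⟨v, hv, hvq⟩ := h i
  refine ⟨fun t => v (unitInterval.symm t), ?_, fun t => hvq _⟩
  exact hv.comp (f := fun p : unitInterval × Circle => (unitInterval.symm p.1, p.2))
    (by fun_prop)

lemma Homotopic.trans {φ ψ χ : Framing o γ} (h : Homotopic φ ψ) (h' : Homotopic ψ χ) :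
    Homotopic φ χ := by
  obtain ⟨Φ, h0, h1, h⟩ := h
  obtain ⟨Ψ, h0', h1', h'⟩ := h'
  let l : unitInterval → unitInterval := fun t => Set.projIcc 0 1 zero_le_one (2 * (t : ℝ))
  let r : unitInterval → unitInterval := fun t => Set.projIcc 0 1 zero_le_one (2 * (t : ℝ) - 1)
  have hl : Continuous l := continuous_projIcc.comp (by fun_prop)
  have hr : Continuous r := continuous_projIcc.comp (by fun_prop)
  have hl1 : ∀ t : unitInterval, (t : ℝ) = 1 / 2 → l t = 1 := fun t ht => by
    simp only [l, ht]; exact Set.projIcc_of_right_le _ (by norm_num)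
  have hr0 : ∀ t : unitInterval, (t : ℝ) = 1 / 2 → r t = 0 := fun t ht => by
    simp only [r, ht]; exact Set.projIcc_of_le_left _ (by norm_num)
  refine ⟨fun t => if (t : ℝ) ≤ 1 / 2 then Φ (l t) else Ψ (r t), ?_, ?_, fun i => ?_⟩
  · have : l 0 = 0 := Set.projIcc_of_le_left _ (by norm_num)
    simp [this, h0]
  · have : r 1 = 1 := Set.projIcc_of_right_le _ (by norm_num)
    have h2 : ¬ (((1 : unitInterval) : ℝ) ≤ 1 / 2) := by norm_num
    simp only [this, h1', h2, if_false]
  obtain ⟨v, hv, hvq⟩ := h i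
  obtain ⟨w, hw, hwq⟩ := h' i
  have hd : Continuous (fun p : unitInterval × Circle => (⟨γ p.2,
      (1 : ℝ) • w p.1 p.2 + (1 : ℝ) • ((1 : ℝ) • v 1 p.2 + (-1 : ℝ) • w 0 p.2)⟩ :
      TangentBundle J Y)) := by
    refine continuous_comb continuous_const continuous_const hw
      (continuous_comb continuous_const continuous_const ?_ ?_)
    · exact hv.comp (f := fun p : unitInterval × Circle => ((1 : unitInterval), p.2))
        (by fun_prop)
    · exact hw.comp (f := fun p : unitInterval × Circle => ((0 : unitInterval), p.2))
        (by fun_prop)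
  refine ⟨fun t z => if (t : ℝ) ≤ 1 / 2 then v (l t) z else
    (1 : ℝ) • w (r t) z + (1 : ℝ) • ((1 : ℝ) • v 1 z + (-1 : ℝ) • w 0 z), ?_, ?_⟩
  · have hc := Continuous.if_le
      (f := fun p : unitInterval × Circle => (p.1 : ℝ)) (g := fun _ => 1 / 2)
      (hv.comp (f := fun p : unitInterval × Circle => (l p.1, p.2)) (by fun_prop))
      (hd.comp (f := fun p : unitInterval × Circle => (r p.1, p.2)) (by fun_prop))
      (by fun_prop) continuous_const (fun p hp => by simp [hl1 p.1 hp, hr0 p.1 hp])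
    refine hc.congr fun p => ?_
    by_cases hp : (p.1 : ℝ) ≤ 1 / 2
    · simp only [hp, if_true]; rfl
    · simp only [hp, if_false]; rfl
  · intro t z
    by_cases ht : (t : ℝ) ≤ 1 / 2
    · simp only [ht, if_true]; exact hvq _ _
    · simp only [ht, if_false, map_add, map_smul, hwq, hvq, h1, h0']
      module

/-- The relation of homotopy through framings. -/
instance framingSetoid (o : ManifoldOrientation J Y) (γ : Circle → Y) : Setoid (Framing o γ) :=
  ⟨Homotopic, Homotopic.refl, Homotopic.symm, Homotopic.trans⟩

/-- The set of framings of `N_Y(γ)` up to homotopy. -/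
def FramingClass (o : ManifoldOrientation J Y) (γ : Circle → Y) : Type _ :=
  Quotient (framingSetoid o γ)

/-- The homotopy class of a framing. -/
def Framing.toClass (φ : Framing o γ) : FramingClass o γ := Quotient.mk _ φ

/-- The matrix of the rotation of the plane by the angle of `u`. -/
def rot (u : Circle) : Matrix (Fin 2) (Fin 2) ℝ :=
  !![(u : ℂ).re, (u : ℂ).im; -(u : ℂ).im, (u : ℂ).re]

lemma contMDiff_rot (k : ℤ) (i j : Fin 2) :
    ContMDiff (𝓡 1) 𝓘(ℝ, ℝ) ∞ (fun z : Circle => rot (z ^ k) i j) := by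
  have : Fact (Module.finrank ℝ ℂ = 1 + 1) := finrank_real_complex_fact'
  have hz : ContMDiff (𝓡 1) (𝓡 1) ∞ (fun z : Circle => z ^ k) := by
    have : LieGroup (𝓡 1) ∞ Circle := LieGroup.of_le (n := ω) le_top
    obtain ⟨m, rfl | rfl⟩ := k.eq_nat_or_neg
    · simpa using contMDiff_pow (I := 𝓡 1) (G := Circle) (n := ∞) m
    · simpa using (contMDiff_pow (I := 𝓡 1) (G := Circle) (n := ∞) m).inv
  have hc : ContMDiff (𝓡 1) 𝓘(ℝ, ℂ) ∞ (fun z : Circle => ((z ^ k : Circle) : ℂ)) :=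
    (contMDiff_coe_sphere (E := ℂ) (n := 1)).comp hz
  have hre : ContMDiff (𝓡 1) 𝓘(ℝ, ℝ) ∞ (fun z : Circle => ((z ^ k : Circle) : ℂ).re) :=
    Complex.reCLM.contMDiff.comp hc
  have him : ContMDiff (𝓡 1) 𝓘(ℝ, ℝ) ∞ (fun z : Circle => ((z ^ k : Circle) : ℂ).im) :=
    Complex.imCLM.contMDiff.comp hc
  fin_cases i <;> fin_cases j
  · exact hre
  · exact him
  · exact him.neg
  · exact hre

/-- The action of `k : ℤ` on framings: the framing is rotated `k` times in the positive direction
as one goes once around `γ`. -/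
def Framing.rotate (k : ℤ) (φ : Framing o γ) : Framing o γ where
  vec i z := rot (z ^ k) i 0 • φ.vec 0 z + rot (z ^ k) i 1 • φ.vec 1 z
  smooth i := by
    obtain ⟨v, hv, hvq⟩ := φ.smooth 0
    obtain ⟨w, hw, hwq⟩ := φ.smooth 1
    exact ⟨_, contMDiff_comb (contMDiff_rot k i 0) (contMDiff_rot k i 1) hv hw,
      fun z => by rw [map_add, map_smul, map_smul, hvq, hwq]⟩
  positive z := by
    obtain ⟨v, hv, b, hb, hbo⟩ := φ.positive z
    have hu : (rot (z ^ k) 0 0) * (rot (z ^ k) 0 0) + rot (z ^ k) 0 1 * rot (z ^ k) 0 1 = 1 := by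
      have := Circle.normSq_coe (z ^ k)
      rw [Complex.normSq_apply] at this
      simpa [rot] using this
    have e1 : rot (z ^ k) 1 0 = - rot (z ^ k) 0 1 := by simp [rot]
    have e2 : rot (z ^ k) 1 1 = rot (z ^ k) 0 0 := by simp [rot]
    have hdet : b.det ![velocity J γ z,
        rot (z ^ k) 0 0 • v 0 + rot (z ^ k) 0 1 • v 1,
        rot (z ^ k) 1 0 • v 0 + rot (z ^ k) 1 1 • v 1] = 1 := by
      have b0 : velocity J γ z = b 0 := by rw [hb]; rfl
      have b1 : v 0 = b 1 := by rw [hb]; rfl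
      have b2 : v 1 = b 2 := by rw [hb]; rfl
      rw [Module.Basis.det_apply, Matrix.det_fin_three, b0, b1, b2, e1, e2]
      simp [Module.Basis.toMatrix_apply]
      linarith
    refine ⟨fun i => rot (z ^ k) i 0 • v 0 + rot (z ^ k) i 1 • v 1,
      fun i => by rw [map_add, map_smul, map_smul, hv, hv], ?_⟩
    have hbas := (Module.Basis.is_basis_iff_det b).2 (hdet ▸ isUnit_one)
    refine ⟨Module.Basis.mk hbas.1 hbas.2.ge, by simp, ?_⟩
    rw [← hbo, eq_comm, Module.Basis.orientation_eq_iff_det_pos, Module.Basis.coe_mk, hdet]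
    exact one_pos

instance : AddAction ℤ (Framing o γ) where
  vadd k φ := φ.rotate k
  zero_vadd φ := by
    ext i z
    change rot (z ^ (0 : ℤ)) i 0 • φ.vec 0 z + rot (z ^ (0 : ℤ)) i 1 • φ.vec 1 z = φ.vec i z
    fin_cases i <;> simp [rot]
  add_vadd j k φ := by
    ext i z
    change rot (z ^ (j + k)) i 0 • φ.vec 0 z + rot (z ^ (j + k)) i 1 • φ.vec 1 z =
      rot (z ^ j) i 0 • (rot (z ^ k) 0 0 • φ.vec 0 z + rot (z ^ k) 0 1 • φ.vec 1 z) +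
      rot (z ^ j) i 1 • (rot (z ^ k) 1 0 • φ.vec 0 z + rot (z ^ k) 1 1 • φ.vec 1 z)
    rw [zpow_add]
    fin_cases i <;> simp [rot] <;> module

lemma Homotopic.vadd {φ ψ : Framing o γ} (k : ℤ) (h : Homotopic φ ψ) :
    Homotopic (k +ᵥ φ) (k +ᵥ ψ) := by
  obtain ⟨Φ, h0, h1, h⟩ := h
  refine ⟨fun t => k +ᵥ Φ t, congrArg (k +ᵥ ·) h0, congrArg (k +ᵥ ·) h1, fun i => ?_⟩
  obtain ⟨v, hv, hvq⟩ := h 0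
  obtain ⟨w, hw, hwq⟩ := h 1
  refine ⟨fun t z => rot (z ^ k) i 0 • v t z + rot (z ^ k) i 1 • w t z,
    continuous_comb ((contMDiff_rot k i 0).continuous.comp continuous_snd)
      ((contMDiff_rot k i 1).continuous.comp continuous_snd) hv hw, fun t z => ?_⟩
  rw [map_add, map_smul, map_smul, hvq, hwq]
  rfl

/-- The induced action of `ℤ` on homotopy classes of framings. -/
instance : AddAction ℤ (FramingClass o γ) where
  vadd k := Quotient.map (k +ᵥ ·) fun _ _ h => h.vadd k
  zero_vadd c := by
    induction c using Quotient.inductionOn with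
    | h φ => exact congrArg Framing.toClass (zero_vadd ℤ φ)
  add_vadd j k c := by
    induction c using Quotient.inductionOn with
    | h φ => exact congrArg Framing.toClass (add_vadd j k φ)

end Curve

section Disk

variable {H : Type*} [TopologicalSpace H]
  {J : ModelWithCorners ℝ (EuclideanSpace ℝ (Fin 3)) H}
  {Y : Type*} [TopologicalSpace Y] [ChartedSpace H Y]
  {G : Type*} [TopologicalSpace G]
  {I : ModelWithCorners ℝ (EuclideanSpace ℝ (Fin 5)) G}
  {W : Type*} [TopologicalSpace W] [ChartedSpace G W]

/-- The closed unit disk in the plane. -/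
abbrev disk : Set ℂ := Metric.closedBall 0 1

variable (I) in
/-- The tangent plane at `Δ z` of a disk `Δ`; only the values of `Δ` on the closed
unit disk matter. -/
abbrev tangentPlane (Δ : ℂ → W) (z : ℂ) : Submodule ℝ (TangentSpace I (Δ z)) :=
  (mfderivWithin 𝓘(ℝ, ℂ) I Δ disk z).range

variable (I) in
/-- The fibre at `Δ z` of the normal bundle `N_W(Δ) = TW|_Δ / TΔ`. -/
abbrev DiskNormal (Δ : ℂ → W) (z : ℂ) : Type _ :=
  TangentSpace I (Δ z) ⧸ tangentPlane I Δ z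

/-- `Δ` is a smoothly embedded disk in `W` with boundary the curve `γ` in `Y`, which
meets `Y` (embedded by `ι`) exactly in `γ` and is not tangent to `Y` there: along `γ`
the tangent spaces of `Y` and `Δ` meet only in the tangent line of `γ`, so that `N_Y(γ)` is a
subbundle of the restriction of `N_W(Δ)` to `γ`. (Tangent spaces at the equal points
`ι (γ z)` and `Δ z` are identified.) -/
structure IsSpanningDisk (J : ModelWithCorners ℝ (EuclideanSpace ℝ (Fin 3)) H)
    (I : ModelWithCorners ℝ (EuclideanSpace ℝ (Fin 5)) G)
    (ι : Y → W) (γ : Circle → Y) (Δ : ℂ → W) : Prop where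
  smooth : ContMDiffOn 𝓘(ℝ, ℂ) I ∞ Δ disk
  injOn : Set.InjOn Δ disk
  immersion : ∀ z ∈ disk, Function.Injective (mfderivWithin 𝓘(ℝ, ℂ) I Δ disk z)
  boundary : ∀ z : Circle, Δ z = ι (γ z)
  inter : Δ '' disk ∩ Set.range ι = Set.range (ι ∘ γ)
  clean : ∀ z : Circle,
    ((mfderiv J I ι (γ z)).range : Submodule ℝ (TangentSpace I (Δ z))) ⊓ tangentPlane I Δ z
      = (tangentLine J γ z).map (mfderiv J I ι (γ z)).toLinearMap

variable [IsManifold I 1 W]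

/-- A section of `N_W(Δ)` is smooth on a set `U` if it is there the class of a smooth vector field
along `Δ`. -/
def IsSmoothDiskNormalSectionOn (Δ : ℂ → W) (s : ∀ z, DiskNormal I Δ z) (U : Set ℂ) : Prop :=
  ∃ v : ∀ z, TangentSpace I (Δ z),
    ContMDiffOn 𝓘(ℝ, ℂ) I.tangent ∞ (fun z => (⟨Δ z, v z⟩ : TangentBundle I W)) U ∧
    ∀ z ∈ U, (tangentPlane I Δ z).mkQ (v z) = s z

/-- `s` is a smooth frame over `U` of the family of subspaces `B` of the fibres of `N_W(Δ)`. -/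
def IsSmoothFrameOn (Δ : ℂ → W) (B : ∀ z, Submodule ℝ (DiskNormal I Δ z)) {k : ℕ}
    (s : Fin k → ∀ z, DiskNormal I Δ z) (U : Set ℂ) : Prop :=
  (∀ i, IsSmoothDiskNormalSectionOn Δ (s i) U) ∧
    ∀ z ∈ U, LinearIndependent ℝ (fun i => s i z) ∧
      Submodule.span ℝ (Set.range fun i => s i z) = B z

/-- The family `B` of subspaces of the fibres of `N_W(Δ)` is a smooth subbundle of rank `k`. -/
def IsSubbundle (Δ : ℂ → W) (k : ℕ) (B : ∀ z, Submodule ℝ (DiskNormal I Δ z)) : Prop :=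
  ∀ z₀ ∈ disk, ∃ U ∈ 𝓝 z₀, ∃ s : Fin k → ∀ z, DiskNormal I Δ z, IsSmoothFrameOn Δ B s (U ∩ disk)

variable [IsManifold J 1 Y]

/-- A framing `φ` of `N_Y(γ)` is `Δ`-admissible if there is a smooth subbundle `B` of rank two of
`N_W(Δ)` with a framing `Φ` that extends `φ`: at the boundary, the differential of `ι` maps
representatives of `φ` to representatives of `Φ`. -/
def Admissible (I : ModelWithCorners ℝ (EuclideanSpace ℝ (Fin 5)) G) [IsManifold I 1 W]
    {o : ManifoldOrientation J Y} {γ : Circle → Y} (ι : Y → W) (Δ : ℂ → W)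
    (φ : Framing o γ) : Prop :=
  ∃ B : ∀ z, Submodule ℝ (DiskNormal I Δ z), IsSubbundle Δ 2 B ∧
    ∃ Φ : Fin 2 → ∀ z, DiskNormal I Δ z, IsSmoothFrameOn Δ B Φ disk ∧
      ∀ (z : Circle) (i : Fin 2) (v : TangentSpace J (γ z)),
        (tangentLine J γ z).mkQ v = φ.vec i z →
          (tangentPlane I Δ z).mkQ (mfderiv J I ι (γ z) v) = Φ i z

end Disk

end

end AmbientSurgery

/-!
The disk is contractible, so `N_W(Δ)` has a frame of three sections over it, and a framing of
`N_Y(γ)`, read in such a frame, becomes a loop of linearly independent pairs in `ℝ³`. The framing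
is admissible exactly when this loop is nullhomotopic: a framed subbundle over the disk is an
extension of the loop to the disk, and a continuous extension can be smoothed. Relative to a fixed
framing, any other framing is a loop of bases of the plane, so its homotopy class is a winding
number. It remains to see that rotating a loop of independent pairs `k` times changes its class in
`π₁(GL⁺(3, ℝ)) = ℤ/2` by `k`. For this we use the double cover `SU(2) → SO(3)`: a spinor
`σ ∈ ℂ² ∖ 0` determines an orthogonal pair in `ℝ³`, and `c • σ` determines that pair rotated by
`c²`. As the sphere in `ℂ²` is simply connected, even rotations are nullhomotopic, while a
nullhomotopy of an odd one would lift to spinors and yield a square root of an odd power on the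
circle.
-/

namespace AmbientSurgery

noncomputable section

section Transport

variable {V F : Type*} [NormedAddCommGroup V] [NormedSpace ℝ V]
  [NormedAddCommGroup F] [NormedSpace ℝ F] {S : Set V} {Q : V → F →L[ℝ] F} {N : ℕ}

/-- Transport along the ray from `0` to `z` cut into `N` steps: the composite of the operators `Q`
at the first `k + 1` subdivision points. If the values of `Q` are projections and the steps are
short, it is a discrete substitute for parallel transport in the bundle of their ranges. -/
def rayTransport (Q : V → F →L[ℝ] F) (N : ℕ) : ℕ → V → F →L[ℝ] F
  | 0, _ => Q 0
  | k + 1, z => (Q (((k + 1 : ℕ) / N : ℝ) • z)).comp (rayTransport Q N k z)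

lemma div_smul_mem (hS : StarConvex ℝ 0 S) {z : V} (hz : z ∈ S) {k : ℕ} (hk : k ≤ N) :
    (k / N : ℝ) • z ∈ S :=
  hS.smul_mem hz (by positivity) (div_le_one_of_le₀ (by exact_mod_cast hk) (by positivity))

lemma contDiffOn_rayTransport {n : WithTop ℕ∞} (hS : StarConvex ℝ 0 S) (hQ : ContDiffOn ℝ n Q S)
    {k : ℕ} (hk : k ≤ N) : ContDiffOn ℝ n (rayTransport Q N k) S := by
  induction k with
  | zero => exact contDiffOn_const
  | succ k ih =>
    exact (hQ.comp (contDiff_const_smul _).contDiffOn fun z hz => div_smul_mem hS hz hk).clm_comp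
      (ih (by omega))

lemma apply_rayTransport (hS : StarConvex ℝ 0 S) (hQ : ∀ z ∈ S, IsIdempotentElem (Q z)) {z : V}
    (hz : z ∈ S) {k : ℕ} (hk : k ≤ N) (f : F) :
    Q ((k / N : ℝ) • z) (rayTransport Q N k z f) = rayTransport Q N k z f := by
  have h := DFunLike.congr_fun (hQ _ (div_smul_mem hS hz hk)).eq
  cases k with
  | zero => simpa [rayTransport] using h f
  | succ k => exact h (rayTransport Q N k z f)

lemma eq_zero_of_norm_sub_lt_one {P Q : F →L[ℝ] F} (h : ‖P - Q‖ < 1) {f : F} (hP : P f = f)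
    (hQ : Q f = 0) : f = 0 := by
  have hle := (P - Q).le_opNorm f
  rw [sub_apply, hP, hQ, sub_zero] at hle
  by_contra hf
  nlinarith [norm_pos_iff.2 hf]

lemma eq_zero_of_rayTransport_eq_zero (hS : StarConvex ℝ 0 S)
    (hQ : ∀ z ∈ S, IsIdempotentElem (Q z)) {z : V} (hz : z ∈ S)
    (hN : ∀ k < N, ‖Q ((k / N : ℝ) • z) - Q (((k + 1 : ℕ) / N : ℝ) • z)‖ < 1) {f : F}
    (hf : Q 0 f = f) {k : ℕ} (hk : k ≤ N) (h : rayTransport Q N k z f = 0) : f = 0 := by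
  induction k with
  | zero => exact hf ▸ h
  | succ k ih =>
    exact ih (by omega)
      (eq_zero_of_norm_sub_lt_one (hN k hk) (apply_rayTransport hS hQ hz (by omega) f) h)

lemma exists_ray_subdivision (hSc : IsCompact S) (hS : StarConvex ℝ 0 S) (hQ : ContinuousOn Q S) :
    ∃ N : ℕ, 0 < N ∧ ∀ z ∈ S, ∀ k < N,
      ‖Q ((k / N : ℝ) • z) - Q (((k + 1 : ℕ) / N : ℝ) • z)‖ < 1 := by
  obtain ⟨δ, hδ, hδQ⟩ := Metric.uniformContinuousOn_iff.1
    (hSc.uniformContinuousOn_of_continuous hQ) 1 one_pos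
  obtain ⟨R, hR⟩ := hSc.isBounded.exists_norm_le
  obtain ⟨N, hN⟩ := exists_nat_gt (max (R / δ) 0)
  have hN0 : (0 : ℝ) < N := (le_max_right _ _).trans_lt hN
  refine ⟨N, by exact_mod_cast hN0, fun z hz k hk => ?_⟩
  rw [← dist_eq_norm]
  refine hδQ _ (div_smul_mem hS hz hk.le) _ (div_smul_mem hS hz hk) ?_
  have hstep : (k / N : ℝ) - ((k + 1 : ℕ) / N : ℝ) = -(1 / N) := by push_cast; ring
  calc dist ((k / N : ℝ) • z) (((k + 1 : ℕ) / N : ℝ) • z) = 1 / N * ‖z‖ := by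
        rw [dist_eq_norm, ← sub_smul, hstep, norm_smul, norm_neg,
          Real.norm_of_nonneg (by positivity)]
    _ ≤ 1 / N * R := by gcongr; exact hR z hz
    _ < δ := by
        rw [one_div_mul_eq_div, div_lt_comm₀ hN0 hδ]
        exact (le_max_left _ _).trans_lt hN

/-- A bundle over a compact star-shaped set that is the range of a family of idempotents is
trivialized by discrete parallel transport along the rays. -/
theorem exists_transport_of_isIdempotentElem {n : WithTop ℕ∞} (hSc : IsCompact S)
    (hS : StarConvex ℝ 0 S) (hQ : ContDiffOn ℝ n Q S) (hidem : ∀ z ∈ S, IsIdempotentElem (Q z)) :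
    ∃ P : V → F →L[ℝ] F, ContDiffOn ℝ n P S ∧
      ∀ z ∈ S, (∀ f, Q z (P z f) = P z f) ∧ ∀ f, Q 0 f = f → P z f = 0 → f = 0 := by
  obtain ⟨N, hN0, hN⟩ := exists_ray_subdivision hSc hS hQ.continuousOn
  refine ⟨rayTransport Q N N, contDiffOn_rayTransport hS hQ le_rfl, fun z hz => ⟨fun f => ?_,
    fun f hf => eq_zero_of_rayTransport_eq_zero hS hidem hz (hN z hz) hf le_rfl⟩⟩
  have h := apply_rayTransport hS hidem hz (le_refl N) f
  rwa [div_self (by exact_mod_cast hN0.ne'), one_smul] at h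

variable {E G : Type*} [NormedAddCommGroup E] [InnerProductSpace ℝ E] [FiniteDimensional ℝ E]
  [NormedAddCommGroup G] [InnerProductSpace ℝ G] [FiniteDimensional ℝ G]

theorem exists_contDiffOn_frame {n : WithTop ℕ∞} (hSc : IsCompact S) (hS : StarConvex ℝ 0 S)
    {K : V → Submodule ℝ E}
    (hK : ContDiffOn ℝ n (fun z => (K z).starProjection) S)
    {m : ℕ} (hm : Module.finrank ℝ (K 0) = m) :
    ∃ b : Fin m → V → E, (∀ i, ContDiffOn ℝ n (b i) S) ∧
      ∀ z ∈ S, (∀ i, b i z ∈ K z) ∧ LinearIndependent ℝ (fun i => b i z) := by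
  obtain ⟨P, hPs, hP⟩ := exists_transport_of_isIdempotentElem hSc hS hK
    fun z _ => (K z).isIdempotentElem_starProjection
  let b := Module.finBasisOfFinrankEq ℝ (K 0) hm
  refine ⟨fun i z => P z (b i), fun i => hPs.clm_apply contDiffOn_const, fun z hz =>
    ⟨fun i => Submodule.starProjection_eq_self_iff.1 ((hP z hz).1 _), ?_⟩⟩
  have hker : LinearMap.ker ((P z).toLinearMap.domRestrict (K 0)) = ⊥ :=
    LinearMap.ker_eq_bot'.2 fun f hf =>
      Subtype.ext ((hP z hz).2 _ (Submodule.starProjection_eq_self_iff.2 f.2) hf)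
  exact b.linearIndependent.map' _ hker

open ContinuousLinearMap in
lemma isInvertible_adjoint_comp_self {L : G →L[ℝ] E} (hL : Function.Injective L) :
    ((adjoint L).comp L).IsInvertible := by
  have hinj : Function.Injective ((adjoint L).comp L) :=
    LinearMap.ker_eq_bot.1 (L.ker_adjoint_comp_self.trans (LinearMap.ker_eq_bot.2 hL))
  exact ⟨(LinearEquiv.ofInjectiveEndo _ hinj).toContinuousLinearEquiv, by ext; rfl⟩

open ContinuousLinearMap in
lemma starProjection_range_eq {L : G →L[ℝ] E} (hL : Function.Injective L) :
    L.range.starProjection = L.comp ((inverse ((adjoint L).comp L)).comp (adjoint L)) := by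
  ext u
  refine Submodule.eq_starProjection_of_mem_of_inner_eq_zero (LinearMap.mem_range_self _ _) ?_
  rintro _ ⟨w, rfl⟩
  have h := (isInvertible_adjoint_comp_self hL).self_apply_inverse (adjoint L u)
  simp only [comp_apply] at h ⊢
  change inner ℝ _ (L w) = 0
  rw [← adjoint_inner_left, map_sub, h, sub_self, inner_zero_left]

open ContinuousLinearMap in
lemma contDiffWithinAt_adjoint {n : WithTop ℕ∞} {L : V → G →L[ℝ] E} {z₀ : V}
    (hL : ContDiffWithinAt ℝ n L S z₀) : ContDiffWithinAt ℝ n (fun z => adjoint (L z)) S z₀ :=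
  let A : (G →L[ℝ] E) →L[ℝ] (E →L[ℝ] G) :=
    (adjoint : (G →L[ℝ] E) ≃ₗᵢ⋆[ℝ] (E →L[ℝ] G)).toLinearIsometry.toContinuousLinearMap
  A.contDiff.comp_contDiffWithinAt hL

open ContinuousLinearMap in
lemma contDiffWithinAt_starProjection_range {n : WithTop ℕ∞} {L : V → G →L[ℝ] E} {z₀ : V}
    (hz₀ : z₀ ∈ S) (hL : ContDiffWithinAt ℝ n L S z₀) {K : V → Submodule ℝ E}
    (hK : ∀ᶠ z in 𝓝[S] z₀, Function.Injective (L z) ∧ K z = (L z).range) :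
    ContDiffWithinAt ℝ n (fun z => (K z).starProjection) S z₀ := by
  have hinj := (hK.self_of_nhdsWithin hz₀).1
  have hadj := contDiffWithinAt_adjoint hL
  have hinv : ContDiffWithinAt ℝ n (fun z => inverse ((adjoint (L z)).comp (L z))) S z₀ :=
    ContDiffAt.comp_contDiffWithinAt (g := inverse) z₀
      (isInvertible_adjoint_comp_self hinj).contDiffAt_map_inverse (hadj.clm_comp hL)
  refine (hL.clm_comp (hinv.clm_comp hadj)).congr_of_eventuallyEq_of_mem ?_ hz₀
  filter_upwards [hK] with z ⟨hz, hKz⟩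
  rw [← starProjection_range_eq hz]
  simp only [hKz]

lemma contDiffWithinAt_starProjection_orthogonal {n : WithTop ℕ∞} {K : V → Submodule ℝ E} {z₀ : V}
    (hK : ContDiffWithinAt ℝ n (fun z => (K z).starProjection) S z₀) :
    ContDiffWithinAt ℝ n (fun z => (K z)ᗮ.starProjection) S z₀ := by
  simp only [Submodule.starProjection_orthogonal]
  exact contDiffWithinAt_const.sub hK

end Transport

section Winding

open Complex Set

lemma exists_mem_Icc_circleExp_eq (z : Circle) :
    ∃ θ ∈ Icc 0 (2 * Real.pi), Circle.exp θ = z := by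
  obtain ⟨θ, hθ, h⟩ := Circle.periodic_exp.exists_mem_Ico₀ Real.two_pi_pos (Complex.arg z)
  exact ⟨θ, Ico_subset_Icc_self hθ, h.symm.trans (Circle.exp_arg z)⟩

theorem exists_continuous_comp_circleExp {X : Type*} [TopologicalSpace X] {f : ℝ → X}
    (hf : ContinuousOn f (Icc 0 (2 * Real.pi))) (h : f 0 = f (2 * Real.pi)) :
    ∃ g : C(Circle, X), ∀ θ ∈ Icc 0 (2 * Real.pi), g (Circle.exp θ) = f θ := by
  have : Fact (0 < 2 * Real.pi) := ⟨Real.two_pi_pos⟩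
  refine ⟨⟨_, (AddCircle.liftIco_zero_continuous h hf).comp
    AddCircle.homeomorphCircle'.symm.continuous⟩, fun θ hθ => ?_⟩
  simp only [ContinuousMap.coe_mk, Function.comp_apply, ← AddCircle.homeomorphCircle'_apply_mk,
    Homeomorph.symm_apply_apply]
  obtain hlt | rfl := hθ.2.lt_or_eq
  · exact AddCircle.liftIco_zero_coe_apply ⟨hθ.1, hlt⟩
  · rw [AddCircle.coe_period, ← h, ← AddCircle.coe_zero]
    exact AddCircle.liftIco_zero_coe_apply (left_mem_Ico.2 Real.two_pi_pos)

theorem exists_exp_eq_of_homotopy {X : Type*} [TopologicalSpace X] {u : unitInterval × X → ℂ}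
    (hu : Continuous u) (hu0 : ∀ p, u p ≠ 0) {g : X → ℂ} (hg : Continuous g)
    (h : ∀ x, exp (g x) = u (0, x)) :
    ∃ G : unitInterval × X → ℂ, Continuous G ∧ ∀ p, exp (G p) = u p := by
  let U : C(unitInterval × X, {z : ℂ // z ≠ 0}) := ⟨fun p => ⟨u p, hu0 p⟩, by fun_prop⟩
  have hU : ∀ x, U (0, x) = ⟨exp (g x), exp_ne_zero _⟩ := fun x => Subtype.ext (h x).symm
  let G := isCoveringMap_exp.liftHomotopy U ⟨g, hg⟩ hU
  exact ⟨G, G.continuous, fun p =>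
    congrArg Subtype.val (congrFun (isCoveringMap_exp.liftHomotopy_lifts U ⟨g, hg⟩ hU) p)⟩

theorem exists_exp_eq_of_contractibleSpace {X : Type*} [TopologicalSpace X] [ContractibleSpace X]
    {u : X → ℂ} (hu : Continuous u) (hu0 : ∀ x, u x ≠ 0) :
    ∃ g : X → ℂ, Continuous g ∧ ∀ x, exp (g x) = u x := by
  obtain ⟨x₀, ⟨F⟩⟩ := id_nullhomotopic X
  obtain ⟨G, hG, hGu⟩ := exists_exp_eq_of_homotopy (u := fun p => u (F.symm p)) (by fun_prop)
    (fun _ => hu0 _) (g := fun _ => log (u x₀)) continuous_const fun x => by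
      simp [exp_log (hu0 x₀)]
  exact ⟨fun x => G (1, x), by fun_prop, fun x => by simp [hGu]⟩

theorem eq_zero_of_zpow_eq_exp {k : ℤ} {g : Circle → ℂ} (hg : Continuous g)
    (h : ∀ z : Circle, ((z ^ k : Circle) : ℂ) = exp (g z)) : k = 0 := by
  have hlifts : (fun θ : ℝ => g (Circle.exp θ)) = fun θ : ℝ => g 1 + k * (θ * I) := by
    refine isCoveringMap_exp.eq_of_comp_eq (by fun_prop) (by fun_prop) (funext fun θ => ?_) 0
      (by simp)
    simp [← h, exp_add, exp_int_mul]
  have hturn := congrFun hlifts (2 * Real.pi)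
  simpa [Real.pi_ne_zero] using hturn

theorem exists_eq_zpow_mul_exp {u : Circle → ℂ} (hu : Continuous u) (hu0 : ∀ z, u z ≠ 0) :
    ∃ (d : ℤ) (g : C(Circle, ℂ)), ∀ z, u z = ((z ^ d : Circle) : ℂ) * exp (g z) := by
  obtain ⟨f, hf, hfu⟩ := exists_exp_eq_of_contractibleSpace
    (u := fun θ : ℝ => u (Circle.exp θ)) (by fun_prop) fun _ => hu0 _
  obtain ⟨d, hd⟩ : ∃ d : ℤ, f (2 * Real.pi) = f 0 + d * (2 * Real.pi * I) :=
    exp_eq_exp_iff_exists_int.1 (by rw [hfu, hfu]; simp)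
  obtain ⟨g, hg⟩ := exists_continuous_comp_circleExp (f := fun θ : ℝ => f θ - d * (θ * I))
    (by fun_prop) (by simp [hd])
  refine ⟨d, g, fun z => ?_⟩
  obtain ⟨θ, hθ, rfl⟩ := exists_mem_Icc_circleExp_eq z
  rw [hg θ hθ, exp_sub, hfu, exp_int_mul, Circle.coe_zpow, Circle.coe_exp,
    mul_div_cancel₀ _ (zpow_ne_zero _ (exp_ne_zero _))]

theorem contMDiff_of_exp {E H M : Type*} [NormedAddCommGroup E] [NormedSpace ℝ E]
    [TopologicalSpace H] [TopologicalSpace M] [ChartedSpace H M] {I : ModelWithCorners ℝ E H}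
    {n : WithTop ℕ∞} {g : M → ℂ} (hg : Continuous g)
    (hu : ContMDiff I 𝓘(ℝ, ℂ) n fun x => exp (g x)) : ContMDiff I 𝓘(ℝ, ℂ) n g := by
  intro x₀
  have hlog : ContDiffAt ℝ n (fun w => log (w / exp (g x₀)) + g x₀) (exp (g x₀)) := by
    refine ContDiffAt.add ?_ contDiffAt_const
    refine ((contDiffAt_log ?_).restrict_scalars ℝ).comp _ (contDiffAt_id.div_const _)
    simp
  refine (hlog.contMDiffAt.comp x₀ (hu x₀)).congr_of_eventuallyEq ?_
  have hnear : ∀ᶠ x in 𝓝 x₀, |(g x - g x₀).im| < Real.pi :=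
    (Continuous.tendsto' (by fun_prop) x₀ 0 (by simp)).eventually_lt_const Real.pi_pos
  filter_upwards [hnear] with x hx
  rw [abs_lt] at hx
  simp [← exp_sub, log_exp hx.1 hx.2.le]

lemma contMDiff_coe_zpow (k : ℤ) {n : WithTop ℕ∞} :
    ContMDiff (𝓡 1) 𝓘(ℝ, ℂ) n fun z : Circle => ((z ^ k : Circle) : ℂ) := by
  have : Fact (Module.finrank ℝ ℂ = 1 + 1) := finrank_real_complex_fact'
  have : LieGroup (𝓡 1) n Circle := LieGroup.of_le (n := ω) le_top
  have hz : ContMDiff (𝓡 1) (𝓡 1) n (fun z : Circle => z ^ k) := by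
    obtain ⟨m, rfl | rfl⟩ := k.eq_nat_or_neg
    · simpa using contMDiff_pow (I := 𝓡 1) (G := Circle) (n := n) m
    · simpa using (contMDiff_pow (I := 𝓡 1) (G := Circle) (n := n) m).inv
  exact contMDiff_coe_sphere.comp hz

lemma im_convex_combination_div_pos {u w e : ℂ} (h : 0 < (w / u).im) (he : e ≠ 0) {t : ℝ}
    (ht0 : 0 ≤ t) (ht1 : t ≤ 1) :
    0 < (((1 - t : ℝ) * (w * e) + (t : ℝ) * I * (u * e)) / (u * e)).im := by
  have hu : u ≠ 0 := fun hu => by simp [hu] at h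
  have hdiv : ((1 - t : ℝ) * (w * e) + (t : ℝ) * I * (u * e)) / (u * e) =
      (1 - t : ℝ) * (w / u) + (t : ℝ) * I := by
    field_simp
  have hpos := convex_Ioi (0 : ℝ) (Set.mem_Ioi.2 h) (Set.mem_Ioi.2 one_pos) (sub_nonneg.2 ht1) ht0
    (sub_add_cancel _ _)
  rw [hdiv]
  simpa using hpos

theorem exists_homotopy_zpow {n : WithTop ℕ∞} {u w : Circle → ℂ}
    (hu : ContMDiff (𝓡 1) 𝓘(ℝ, ℂ) n u) (hw : ContMDiff (𝓡 1) 𝓘(ℝ, ℂ) n w)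
    (hpos : ∀ z, 0 < (w z / u z).im) :
    ∃ (d : ℤ) (U W : unitInterval × Circle → ℂ), Continuous U ∧ Continuous W ∧
      (∀ t, ContMDiff (𝓡 1) 𝓘(ℝ, ℂ) n (fun z => U (t, z)) ∧
        ContMDiff (𝓡 1) 𝓘(ℝ, ℂ) n (fun z => W (t, z))) ∧
      (∀ p, 0 < (W p / U p).im) ∧
      ∀ z, U (0, z) = u z ∧ W (0, z) = w z ∧
        U (1, z) = (z ^ d : Circle) ∧ W (1, z) = I * (z ^ d : Circle) := by
  have hu0 : ∀ z, u z ≠ 0 := fun z h => by simpa [h] using hpos z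
  obtain ⟨d, g, hg⟩ := exists_eq_zpow_mul_exp hu.continuous hu0
  have hmul {f h : Circle → ℂ} (hf : ContMDiff (𝓡 1) 𝓘(ℝ, ℂ) n f)
      (hh : ContMDiff (𝓡 1) 𝓘(ℝ, ℂ) n h) : ContMDiff (𝓡 1) 𝓘(ℝ, ℂ) n fun z => f z * h z :=
    contDiff_mul.contMDiff.comp (hf.prodMk_space hh)
  have hgn : ContMDiff (𝓡 1) 𝓘(ℝ, ℂ) n g := contMDiff_of_exp g.continuous <|
    (hmul (contMDiff_coe_zpow (-d)) hu).congr fun z => by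
      rw [hg, ← mul_assoc, ← Circle.coe_mul, ← _root_.zpow_add]
      simp
  have hexp (c : ℂ) : ContMDiff (𝓡 1) 𝓘(ℝ, ℂ) n fun z => exp (c * g z) :=
    (contDiff_exp.comp (contDiff_const.mul contDiff_id)).contMDiff.comp hgn
  have hcont : Continuous fun p : unitInterval × Circle => ((p.2 ^ d : Circle) : ℂ) :=
    (contMDiff_coe_zpow (n := 0) d).continuous.comp continuous_snd
  have hw' := hw.continuous
  let U : unitInterval × Circle → ℂ := fun p => (p.2 ^ d : Circle) * exp ((1 - p.1 : ℝ) * g p.2)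
  have hUn (t : unitInterval) : ContMDiff (𝓡 1) 𝓘(ℝ, ℂ) n fun z => U (t, z) :=
    hmul (contMDiff_coe_zpow d) (hexp (1 - t : ℝ))
  have hU : Continuous U := by fun_prop
  refine ⟨d, U, fun p => (1 - p.1 : ℝ) * (w p.2 * exp ((-p.1 : ℝ) * g p.2)) + (p.1 : ℝ) * I * U p,
    hU, by fun_prop, fun t => ⟨hUn t, ?_⟩, fun ⟨t, z⟩ => ?_, fun z => ⟨?_, ?_, ?_, ?_⟩⟩
  · exact contDiff_add.contMDiff.comp ((hmul (contMDiff_const (c := ((1 - t : ℝ) : ℂ)))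
      (hmul hw (hexp (-t : ℝ)))).prodMk_space
        (hmul (contMDiff_const (c := (t : ℝ) * I)) (hUn t)))
  · have hUz : U (t, z) = u z * exp ((-t : ℝ) * g z) := by
      rw [hg, mul_assoc, ← exp_add]
      simp only [U]
      congr 2
      push_cast
      ring
    simp only [hUz]
    exact im_convex_combination_div_pos (hpos z) (exp_ne_zero _) t.2.1 t.2.2
  · simp [U, hg]
  · simp [U]
  · simp [U]
  · simp [U]

end Winding

section Loops

open Set

lemma coe_mem_disk (z : Circle) : (z : ℂ) ∈ disk :=
  mem_closedBall_zero_iff.2 (Circle.norm_coe z).le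

lemma homotopic_of_segment_subset {X E : Type*} [TopologicalSpace X] [AddCommGroup E] [Module ℝ E]
    [TopologicalSpace E] [ContinuousAdd E] [ContinuousSMul ℝ E] {S : Set E} {f g : C(X, S)}
    (h : ∀ x, segment ℝ (f x : E) (g x) ⊆ S) : f.Homotopic g :=
  ⟨{ toFun := fun p => ⟨(1 - p.1 : ℝ) • (f p.2 : E) + (p.1 : ℝ) • (g p.2 : E),
      h p.2 ⟨_, _, sub_nonneg.2 p.1.2.2, p.1.2.1, sub_add_cancel _ _, rfl⟩⟩
     continuous_toFun := by fun_prop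
     map_zero_left := fun x => by simp
     map_one_left := fun x => by simp }⟩

/-- Polar coordinates on the closed unit disk. -/
def polar : C(unitInterval × Circle, disk) where
  toFun p := ⟨(p.1 : ℝ) • (p.2 : ℂ), by
    simpa [norm_smul, Circle.norm_coe, abs_of_nonneg p.1.2.1] using p.1.2.2⟩

lemma norm_polar (p : unitInterval × Circle) : ‖(polar p : ℂ)‖ = p.1 := by
  simp [polar, Circle.norm_coe, abs_of_nonneg p.1.2.1]

lemma polar_one (z : Circle) : (polar (1, z) : ℂ) = z := by simp [polar]

lemma eq_of_polar_eq {r s : unitInterval} {z w : Circle} (h : polar (r, z) = polar (s, w)) :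
    r = s ∧ (r = 0 ∨ z = w) := by
  obtain rfl : r = s := Subtype.ext <| by
    simpa only [norm_polar] using congrArg (fun x : disk => ‖(x : ℂ)‖) h
  refine ⟨rfl, or_iff_not_imp_left.2 fun hr => Circle.ext ?_⟩
  exact smul_right_injective ℂ (fun h0 => hr (Subtype.ext h0)) (congrArg Subtype.val h)

lemma isQuotientMap_polar : IsQuotientMap polar := by
  refine IsQuotientMap.of_surjective_continuous ?_ polar.continuous
  rintro ⟨w, hw⟩
  rw [mem_closedBall_zero_iff] at hw
  refine ⟨(⟨‖w‖, norm_nonneg w, hw⟩, Circle.exp (Complex.arg w)), Subtype.ext ?_⟩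
  simp [polar]

theorem nullhomotopic_iff_exists_extension {E : Type*} [TopologicalSpace E] {S : Set E}
    (u : C(Circle, S)) :
    u.Nullhomotopic ↔
      ∃ F : ℂ → E, ContinuousOn F disk ∧ MapsTo F disk S ∧ ∀ z : Circle, F z = u z := by
  constructor
  · rintro ⟨y, hy⟩
    obtain ⟨H⟩ := hy.symm
    have hH : Function.FactorsThrough H.toContinuousMap polar := by
      rintro ⟨r, z⟩ ⟨s, w⟩ h
      obtain ⟨rfl, rfl | rfl⟩ := eq_of_polar_eq h
      · simp
      · rfl
    let F : C(disk, S) := isQuotientMap_polar.lift _ hH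
    let F' : ℂ → E := Function.extend Subtype.val (fun w => (F w : E)) fun _ => y
    have hF' : ∀ w : disk, F' w = F w := Subtype.val_injective.extend_apply _ _
    refine ⟨F', ?_, fun w hw => ?_, fun z => ?_⟩
    · rw [continuousOn_iff_continuous_domRestrict]
      exact (continuous_subtype_val.comp F.continuous).congr fun w => (hF' w).symm
    · rw [hF' ⟨w, hw⟩]
      exact (F ⟨w, hw⟩).2
    · rw [← polar_one, hF', ← H.apply_one z]
      exact congrArg Subtype.val (DFunLike.congr_fun (isQuotientMap_polar.lift_comp _ hH) (1, z))
  · rintro ⟨F, hF, hFS, hu⟩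
    let F' : C(disk, S) := ⟨_, hF.mapsToRestrict hFS⟩
    refine ⟨F' ⟨0, by simp⟩, ContinuousMap.Homotopic.symm ⟨{
      toContinuousMap := F'.comp polar
      map_zero_left := fun z => ?_
      map_one_left := fun z => ?_ }⟩⟩
    · exact congrArg F' (Subtype.ext (by simp [polar]))
    · exact Subtype.ext ((congrArg F (polar_one z)).trans (hu z))

/-- Every loop in the complement of the origin of a space of dimension at least 3 is contractible:
after smoothing, the cone over the loop misses some direction, by Sard's theorem. -/
theorem nullhomotopic_of_two_lt_finrank {E : Type*} [NormedAddCommGroup E] [NormedSpace ℝ E]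
    (hE : 2 < Module.finrank ℝ E) (u : C(Circle, ({0}ᶜ : Set E))) :
    u.Nullhomotopic := by
  have : FiniteDimensional ℝ E := Module.finite_of_finrank_pos (by omega)
  obtain ⟨v, hv⟩ := exists_contMDiffMap_forall_mem_convex_of_local_const (n := (⊤ : ℕ∞)) (𝓡 1)
    (t := fun z => Metric.ball (u z : E) ‖(u z : E)‖) (fun z => convex_ball _ _) fun z => by
      have hcont : Continuous fun y => ‖(u y : E)‖ - dist (u z : E) (u y) := by fun_prop
      have hz : 0 < ‖(u z : E)‖ - dist (u z : E) (u z) := by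
        simpa only [dist_self, sub_zero] using norm_pos_iff.2 (u z).2
      exact ⟨u z, (hcont.continuousAt.eventually_const_lt hz).mono fun y hy => sub_pos.1 hy⟩
  have hv0 : ∀ z, v z ≠ 0 := fun z h => by simpa [h] using hv z
  have hcone : ContDiff ℝ 1 fun p : ℝ × ℝ => p.1 • v (Circle.exp p.2) := by
    refine contDiff_fst.smul (ContMDiff.contDiff ?_)
    exact (v.contMDiff.of_le (by simp)).comp
      ((contMDiff_circleExp.of_le le_top).comp contDiff_snd.contMDiff)
  obtain ⟨w, hw⟩ := (hcone.dense_compl_range_of_finrank_lt_finrank (by simpa using hE)).nonempty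
  let v' : C(Circle, ({0}ᶜ : Set E)) := ⟨fun z => ⟨v z, hv0 z⟩, by
    have := v.contMDiff.continuous
    fun_prop⟩
  have hw' : ∀ (r : ℝ) (z : Circle), r • v z ≠ w := fun r z h => hw
    ⟨(r, Complex.arg z), by simpa using h⟩
  have huv : u.Homotopic v' := homotopic_of_segment_subset fun z x hx => by
    have := (convex_ball (u z : E) ‖(u z : E)‖).segment_subset
      (Metric.mem_ball_self (norm_pos_iff.2 (u z).2)) (hv z) hx
    rintro rfl
    simp at this
  refine ⟨⟨w, fun h => hw' 0 1 (by simpa using h.symm)⟩, huv.trans ?_⟩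
  refine homotopic_of_segment_subset fun z => ?_
  rintro _ ⟨s, t, -, -, hst, rfl⟩ (h : s • v z + t • w = 0)
  obtain rfl | ht := eq_or_ne t 0
  · exact hv0 z (by simpa [show s = 1 by linarith] using h)
  · refine hw' (-(t⁻¹ * s)) z ?_
    rw [neg_smul, mul_smul, neg_eq_iff_eq_neg, inv_smul_eq_iff₀ ht, smul_neg]
    exact eq_neg_of_add_eq_zero_left h

lemma eventually_mem_ball {X E : Type*} [TopologicalSpace X] [PseudoMetricSpace E] {S : Set X}
    (hS : IsClosed S) {F c : X → E} (hF : ContinuousOn F S) {ε : ℝ} (hε : 0 < ε) {x₀ : X}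
    (hc : ContinuousAt c x₀) (hx₀ : x₀ ∈ S → c x₀ = F x₀) :
    ∀ᶠ x in 𝓝 x₀, x ∈ S → c x ∈ Metric.ball (F x) ε := by
  by_cases h : x₀ ∈ S
  · refine eventually_nhdsWithin_iff.1
      ((hc.continuousWithinAt.dist (hF x₀ h)).eventually_lt_const ?_)
    rwa [hx₀ h, dist_self]
  · filter_upwards [hS.isOpen_compl.mem_nhds h] with x hx hx'
    exact (hx hx').elim

variable {E : Type*} [NormedAddCommGroup E] [NormedSpace ℝ E]

lemma contDiffOn_angular {a : Circle → E} (ha : ContMDiff (𝓡 1) 𝓘(ℝ, E) ∞ a) (z : Circle) :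
    ContDiffOn ℝ ∞ (fun y : ℂ => a (Circle.exp (Complex.arg (y / z)) * z))
      {y | y / z ∈ Complex.slitPlane} := fun y hy => ContDiffAt.contDiffWithinAt <| by
  have hlog : ContDiffAt ℝ ∞ (fun y : ℂ => Complex.log (y / z)) y :=
    ContDiffAt.comp y ((Complex.contDiffAt_log hy).restrict_scalars ℝ) (contDiffAt_id.div_const _)
  have harg : ContDiffAt ℝ ∞ (fun y : ℂ => Complex.arg (y / z)) y := by
    simpa only [Function.comp_def, Complex.imCLM_apply, Complex.log_im] using
      Complex.imCLM.contDiff.contDiffAt.comp y hlog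
  have : LieGroup (𝓡 1) ∞ Circle := LieGroup.of_le (n := ω) le_top
  have hexp : ContMDiffAt 𝓘(ℝ, ℂ) (𝓡 1) ∞
      (fun y : ℂ => Circle.exp (Complex.arg (y / z)) * z) y :=
    ((contMDiff_circleExp.of_le le_top).contMDiffAt.comp y harg.contMDiffAt).mul contMDiffAt_const
  exact (ha.contMDiffAt.comp y hexp).contDiffAt

lemma circleExp_arg_div_mul {y : ℂ} (hy : ‖y‖ = 1) (z : Circle) :
    ((Circle.exp (Complex.arg (y / z)) * z : Circle) : ℂ) = y := by
  have h : ‖y / z‖ = 1 := by rw [norm_div, hy, Circle.norm_coe, div_one]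
  have := Complex.norm_mul_exp_arg_mul_I (y / z)
  rw [h, Complex.ofReal_one, one_mul] at this
  rw [Circle.coe_mul, Circle.coe_exp, this, div_mul_cancel₀ _ z.coe_ne_zero]

theorem exists_contDiff_extension {S : Set E} (hS : IsOpen S) {a : Circle → E}
    (ha : ContMDiff (𝓡 1) 𝓘(ℝ, E) ∞ a) {F : ℂ → E} (hF : ContinuousOn F disk)
    (hFS : MapsTo F disk S) (hFa : ∀ z : Circle, F z = a z) :
    ∃ f : ℂ → E, ContDiff ℝ ∞ f ∧ MapsTo f disk S ∧ ∀ z : Circle, f z = a z := by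
  obtain ⟨ε, hε, hεS⟩ := ((isCompact_closedBall 0 1).image_of_continuousOn hF
    ).exists_thickening_subset_open hS hFS.image_subset
  have hS' : ∀ y ∈ disk, Metric.ball (F y) ε ⊆ S := fun y hy =>
    (Metric.ball_subset_thickening (mem_image_of_mem F hy) ε).trans hεS
  let t : ℂ → Set E := fun y =>
    (⋂ _ : y ∈ disk, Metric.ball (F y) ε) ∩ ⋂ _ : y ∈ Metric.sphere 0 1, {F y}
  have ht : ∀ y, Convex ℝ (t y) := fun y =>
    (convex_iInter fun _ => convex_ball _ _).inter (convex_iInter fun _ => convex_singleton _)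
  have hnear (y₀ : ℂ) {c : ℂ → E} :=
    eventually_mem_ball Metric.isClosed_closedBall hF hε (x₀ := y₀) (c := c)
  obtain ⟨f, hf⟩ := exists_contMDiffMap_forall_mem_convex_of_local (n := ⊤) 𝓘(ℝ, ℂ) ht fun y₀ => by
    by_cases hy₀ : y₀ ∈ Metric.sphere (0 : ℂ) 1
    · obtain ⟨z, rfl⟩ : ∃ z : Circle, z = y₀ := ⟨⟨y₀, hy₀⟩, rfl⟩
      let U : Set ℂ := {y | y / z ∈ Complex.slitPlane}
      have hU : U ∈ 𝓝 (z : ℂ) := (Complex.isOpen_slitPlane.preimage (by fun_prop)).mem_nhds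
        (by simp)
      have hc := (contDiffOn_angular ha z).continuousOn.continuousAt hU
      refine ⟨_, Filter.inter_mem (hnear z hc fun _ => ?_) hU, _,
        ((contDiffOn_angular ha z).mono inter_subset_right).contMDiffOn, fun y hy => ⟨?_, ?_⟩⟩
      · simp [hFa]
      · exact mem_iInter.2 hy.1
      · refine mem_iInter.2 fun h => ?_
        rw [mem_singleton_iff, ← hFa, circleExp_arg_div_mul (mem_sphere_zero_iff_norm.1 h)]
    · refine ⟨_, Filter.inter_mem (hnear y₀ continuousAt_const fun _ => rfl)
        (Metric.isClosed_sphere.isOpen_compl.mem_nhds hy₀), fun _ => F y₀, contMDiffOn_const, ?_⟩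
      exact fun y hy => ⟨mem_iInter.2 hy.1, mem_iInter.2 fun h => (hy.2 h).elim⟩
  refine ⟨f, f.contMDiff.contDiff, fun y hy => hS' y hy (mem_iInter.1 (hf y).1 hy), fun z => ?_⟩
  exact (mem_iInter.1 (hf z).2 (by simp [Circle.norm_coe])).trans (hFa z)

end Loops

section PlaneComb

variable {M M' : Type*} [AddCommGroup M] [Module ℝ M] [AddCommGroup M'] [Module ℝ M']

/-- The combination of a pair of vectors with the real and imaginary parts of `u` as
coefficients. -/
def planeComb (u : ℂ) (x : M × M) : M := u.re • x.1 + u.im • x.2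

/-- The pair obtained from `x` by the rotation of angle `arg u` and the dilation of factor `‖u‖` in
the plane with basis `x`. -/
def rotatePair (u : ℂ) (x : M × M) : M × M := (planeComb u x, planeComb (Complex.I * u) x)

lemma planeComb_rotatePair (a u : ℂ) (x : M × M) :
    planeComb a (rotatePair u x) = planeComb (a * u) x := by
  simp only [planeComb, rotatePair, Complex.mul_re, Complex.mul_im, Complex.I_re, Complex.I_im]
  module

lemma rotatePair_rotatePair (a u : ℂ) (x : M × M) :
    rotatePair a (rotatePair u x) = rotatePair (a * u) x := by
  rw [rotatePair, planeComb_rotatePair, planeComb_rotatePair, mul_assoc, rotatePair]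

lemma planeComb_injective {x : M × M} (hx : LinearIndependent ℝ ![x.1, x.2]) :
    Function.Injective fun u => planeComb u x := fun u w h => by
  have h0 : (u.re - w.re) • x.1 + (u.im - w.im) • x.2 = 0 := by
    simp only [planeComb] at h
    linear_combination (norm := module) h
  obtain ⟨hre, him⟩ := LinearIndependent.pair_iff.1 hx _ _ h0
  exact Complex.ext (sub_eq_zero.1 hre) (sub_eq_zero.1 him)

lemma linearIndependent_planeComb {x : M × M} (hx : LinearIndependent ℝ ![x.1, x.2]) {u w : ℂ}
    (h : (w / u).im ≠ 0) : LinearIndependent ℝ ![planeComb u x, planeComb w x] := by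
  refine (LinearIndependent.pair_add_smul_add_smul_iff _ _ _ _).2 ⟨hx, fun h0 => h ?_⟩
  rw [Complex.div_im]
  linear_combination h0 / Complex.normSq u

lemma map_planeComb (A : M →ₗ[ℝ] M') (u : ℂ) (x : M × M) :
    A (planeComb u x) = planeComb u (A x.1, A x.2) := by
  simp only [planeComb, map_add, map_smul]

lemma linearIndependent_pair_map_iff {A : M →ₗ[ℝ] M'} (hA : Function.Injective A) (x : M × M) :
    LinearIndependent ℝ ![(Prod.map A A x).1, (Prod.map A A x).2] ↔
      LinearIndependent ℝ ![x.1, x.2] := by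
  have h : ![A x.1, A x.2] = A ∘ ![x.1, x.2] := funext fun i => by fin_cases i <;> rfl
  rw [Prod.map_fst, Prod.map_snd, h]
  exact A.linearIndependent_iff (LinearMap.ker_eq_bot.2 hA)

lemma prodMap_rotatePair (A : M →ₗ[ℝ] M') (u : ℂ) (x : M × M) :
    Prod.map A A (rotatePair u x) = rotatePair u (Prod.map A A x) :=
  Prod.ext (map_planeComb A u x) (map_planeComb A (Complex.I * u) x)

open Complex ComplexConjugate in
lemma im_div_eq (a b : ℂ) : (b / a).im = (conj a * b).im / normSq a := by
  rw [div_im, mul_im, conj_re, conj_im]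
  ring

lemma im_div_pos_iff {u w : ℂ} : 0 < (w / u).im ↔ 0 < u.re * w.im - u.im * w.re := by
  rcases eq_or_ne u 0 with rfl | hu
  · simp
  · rw [im_div_eq, div_pos_iff_of_pos_right (Complex.normSq_pos.2 hu), Complex.mul_im,
      Complex.conj_re, Complex.conj_im, neg_mul, ← sub_eq_add_neg]

lemma det_planeComb (b : Module.Basis (Fin 3) ℝ M) (s t : ℝ) (u w : ℂ) :
    b.det ![b 0, s • b 0 + planeComb u (b 1, b 2), t • b 0 + planeComb w (b 1, b 2)] =
      u.re * w.im - u.im * w.re := by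
  simp [Module.Basis.det_apply, Matrix.det_fin_three, Module.Basis.toMatrix_apply, planeComb,
    mul_comm]

end PlaneComb

section Parity

open Complex Matrix ComplexConjugate

/-- The space of linearly independent pairs of vectors of `ℝ³`. -/
def independentPairs : Set ((Fin 3 → ℝ) × (Fin 3 → ℝ)) := {x | LinearIndependent ℝ ![x.1, x.2]}

lemma rotatePair_zpow_mem (k : ℤ) (z : Circle) {x : (Fin 3 → ℝ) × (Fin 3 → ℝ)}
    (hx : x ∈ independentPairs) : rotatePair ((z ^ k : Circle) : ℂ) x ∈ independentPairs :=
  linearIndependent_planeComb hx <| by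
    rw [mul_div_cancel_right₀ _ (z ^ k).coe_ne_zero]
    exact one_ne_zero

/-- The rotation of a pair by `k` turns along the circle. -/
def rotateAlong (k : ℤ) : C(Circle × independentPairs, independentPairs) where
  toFun p := ⟨rotatePair ((p.1 ^ k : Circle) : ℂ) p.2, rotatePair_zpow_mem k p.1 p.2.2⟩
  continuous_toFun := by
    have hz : Continuous fun z : Circle => ((z ^ k : Circle) : ℂ) :=
      (contMDiff_coe_zpow (n := 0) k).continuous
    have hz' : Continuous fun p : Circle × independentPairs => ((p.1 ^ k : Circle) : ℂ) :=
      hz.comp continuous_fst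
    unfold rotatePair planeComb
    fun_prop

/-- The action of `k : ℤ` on loops of pairs, by `k` turns along the loop. -/
def rotateLoop (k : ℤ) (α : C(Circle, independentPairs)) : C(Circle, independentPairs) :=
  (rotateAlong k).comp ((ContinuousMap.id Circle).prodMk α)

lemma coe_rotateLoop_apply (k : ℤ) (α : C(Circle, independentPairs)) (z : Circle) :
    (rotateLoop k α z : (Fin 3 → ℝ) × (Fin 3 → ℝ)) = rotatePair ((z ^ k : Circle) : ℂ) (α z) := rfl

lemma rotateLoop_rotateLoop (k d : ℤ) (α : C(Circle, independentPairs)) :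
    rotateLoop k (rotateLoop d α) = rotateLoop (k + d) α := by
  ext1 z
  refine Subtype.ext ?_
  simp only [coe_rotateLoop_apply, rotatePair_rotatePair, ← Circle.coe_mul, ← _root_.zpow_add]

lemma rotateLoop_homotopic (k : ℤ) {α β : C(Circle, independentPairs)} (h : α.Homotopic β) :
    (rotateLoop k α).Homotopic (rotateLoop k β) :=
  (ContinuousMap.Homotopic.refl _).comp ((ContinuousMap.Homotopic.refl _).prodMk h)

/-- The Pauli matrices, in the convention for which the axis of a spinor `(s, t)` is
`(2 Re (s̄ t), -2 Im (s̄ t), |s|² - |t|²)`. -/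
def pauli : (Fin 3 → ℝ) →L[ℝ] ℂ × ℂ →L[ℝ] ℂ × ℂ :=
  (ContinuousLinearMap.proj 0).smulRight (.prod (.snd ℝ ℂ ℂ) (.fst ℝ ℂ ℂ)) +
    (ContinuousLinearMap.proj 1).smulRight (.prod (I • .snd ℝ ℂ ℂ) (-I • .fst ℝ ℂ ℂ)) +
    (ContinuousLinearMap.proj 2).smulRight (.prod (.fst ℝ ℂ ℂ) (-.snd ℝ ℂ ℂ))

lemma pauli_apply (n : Fin 3 → ℝ) (σ : ℂ × ℂ) :
    pauli n σ = (n 0 * σ.2 + n 1 * (I * σ.2) + n 2 * σ.1,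
      n 0 * σ.1 - n 1 * (I * σ.1) - n 2 * σ.2) := by
  ext1
  · simp [pauli]
  · simp [pauli]
    ring

lemma pauli_pauli (n : Fin 3 → ℝ) (σ : ℂ × ℂ) : pauli n (pauli n σ) = (n ⬝ᵥ n) • σ := by
  simp only [pauli_apply, dotProduct, Fin.sum_univ_three]
  refine Prod.ext ?_ ?_ <;>
    simp only [Prod.smul_fst, Prod.smul_snd, real_smul, ofReal_add, ofReal_mul]
  · linear_combination (-(n 1 : ℂ) ^ 2 * σ.1) * I_sq
  · linear_combination (-(n 1 : ℂ) ^ 2 * σ.2) * I_sq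

/-- The square of the Hermitian norm. -/
def spinorNormSq (σ : ℂ × ℂ) : ℝ := normSq σ.1 + normSq σ.2

/-- The oriented orthogonal pair `(re v, -im v)` of Cartan's isotropic vector
`v = (s² - t², -i (s² + t²), -2 s t)` attached to the spinor `σ = (s, t)`. -/
def spinorPair (σ : ℂ × ℂ) : (Fin 3 → ℝ) × (Fin 3 → ℝ) :=
  (![(σ.1 ^ 2 - σ.2 ^ 2).re, (σ.1 ^ 2 + σ.2 ^ 2).im, -2 * (σ.1 * σ.2).re],
    ![-(σ.1 ^ 2 - σ.2 ^ 2).im, (σ.1 ^ 2 + σ.2 ^ 2).re, 2 * (σ.1 * σ.2).im])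

/-- The image of the spinor `σ` under the Hopf map, which is the `spinorNormSq σ`-eigendirection:
`pauli (spinorAxis σ) σ = spinorNormSq σ • σ`. -/
def spinorAxis (σ : ℂ × ℂ) : Fin 3 → ℝ :=
  ![2 * (conj σ.1 * σ.2).re, -2 * (conj σ.1 * σ.2).im, normSq σ.1 - normSq σ.2]

lemma cross_spinorPair (σ : ℂ × ℂ) :
    (spinorPair σ).1 ⨯₃ (spinorPair σ).2 = spinorNormSq σ • spinorAxis σ := by
  obtain ⟨⟨a, b⟩, ⟨c, d⟩⟩ := σ
  ext i
  fin_cases i <;>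
    simp [cross_apply, spinorPair, spinorNormSq, spinorAxis, pow_two, normSq_apply] <;> ring

lemma dotProduct_spinorAxis_self (σ : ℂ × ℂ) :
    spinorAxis σ ⬝ᵥ spinorAxis σ = spinorNormSq σ ^ 2 := by
  obtain ⟨⟨a, b⟩, ⟨c, d⟩⟩ := σ
  simp [spinorNormSq, spinorAxis, normSq_apply]
  ring

lemma pauli_spinorAxis (σ : ℂ × ℂ) : pauli (spinorAxis σ) σ = spinorNormSq σ • σ := by
  obtain ⟨⟨a, b⟩, ⟨c, d⟩⟩ := σ
  rw [pauli_apply]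
  refine Prod.ext (Complex.ext ?_ ?_) (Complex.ext ?_ ?_) <;>
    simp [spinorNormSq, spinorAxis, normSq_apply] <;> ring

/-- The Hermitian coefficient of `τ` along `σ`. -/
def spinorRatio (σ τ : ℂ × ℂ) : ℂ := (conj σ.1 * τ.1 + conj σ.2 * τ.2) / spinorNormSq σ

lemma spinorNormSq_smul_add_pauli (σ τ : ℂ × ℂ) :
    spinorNormSq σ • τ + pauli (spinorAxis σ) τ = (2 * (conj σ.1 * τ.1 + conj σ.2 * τ.2)) • σ := by
  obtain ⟨⟨a, b⟩, ⟨c, d⟩⟩ := σ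
  obtain ⟨⟨e, f⟩, ⟨g, h⟩⟩ := τ
  rw [pauli_apply]
  refine Prod.ext (Complex.ext ?_ ?_) (Complex.ext ?_ ?_) <;>
    simp [spinorNormSq, spinorAxis, normSq_apply] <;> ring

lemma spinorNormSq_sq_smul (σ : ℂ × ℂ) (x : Fin 3 → ℝ) :
    spinorNormSq σ ^ 2 • x = (x ⬝ᵥ (spinorPair σ).1) • (spinorPair σ).1 +
      (x ⬝ᵥ (spinorPair σ).2) • (spinorPair σ).2 + (x ⬝ᵥ spinorAxis σ) • spinorAxis σ := by
  obtain ⟨⟨a, b⟩, ⟨c, d⟩⟩ := σ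
  ext i
  fin_cases i <;>
    simp [dotProduct, Fin.sum_univ_three, spinorPair, spinorNormSq, spinorAxis, pow_two,
      normSq_apply] <;> ring

lemma spinorPair_smul (c : ℂ) (σ : ℂ × ℂ) :
    spinorPair (c • σ) = rotatePair (c ^ 2) (spinorPair σ) := by
  obtain ⟨⟨a, b⟩, ⟨c, d⟩⟩ := σ
  ext i <;> fin_cases i <;>
    simp [spinorPair, rotatePair, planeComb, pow_two] <;> ring

/-- `σ` is a spinor of the oriented plane spanned by the pair `x`: an eigenvector of the Pauli
matrix of its normal vector `n = x.1 ⨯₃ x.2` for the positive eigenvalue `‖n‖`. -/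
def IsSpinor (σ : ℂ × ℂ) (x : (Fin 3 → ℝ) × (Fin 3 → ℝ)) : Prop :=
  σ ≠ 0 ∧ pauli (x.1 ⨯₃ x.2) σ = √((x.1 ⨯₃ x.2) ⬝ᵥ (x.1 ⨯₃ x.2)) • σ

lemma pauli_smul (n : Fin 3 → ℝ) (c : ℂ) (σ : ℂ × ℂ) : pauli n (c • σ) = c • pauli n σ := by
  simp only [pauli_apply]
  ext1 <;> simp <;> ring

lemma IsSpinor.smul {σ : ℂ × ℂ} {x} (h : IsSpinor σ x) {c : ℂ} (hc : c ≠ 0) :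
    IsSpinor (c • σ) x :=
  ⟨smul_ne_zero hc h.1, by rw [pauli_smul, h.2, smul_comm]⟩

lemma spinorNormSq_pos {σ : ℂ × ℂ} (h : σ ≠ 0) : 0 < spinorNormSq σ := by
  rcases eq_or_ne σ.1 0 with h1 | h1
  · exact add_pos_of_nonneg_of_pos (normSq_nonneg _)
      (normSq_pos.2 fun h2 => h (Prod.ext h1 h2))
  · exact add_pos_of_pos_of_nonneg (normSq_pos.2 h1) (normSq_nonneg _)

lemma dotProduct_cross_self_pos {x : (Fin 3 → ℝ) × (Fin 3 → ℝ)} (hx : x ∈ independentPairs) :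
    0 < (x.1 ⨯₃ x.2) ⬝ᵥ (x.1 ⨯₃ x.2) :=
  dotProduct_self_star_pos_iff.2 (crossProduct_ne_zero_iff_linearIndependent.2 hx)

lemma smul_eq_smul_spinorAxis {n : Fin 3 → ℝ} {σ : ℂ × ℂ} {r : ℝ} (h : pauli n σ = r • σ) :
    spinorNormSq σ • n = r • spinorAxis σ := by
  obtain ⟨⟨a, b⟩, ⟨c, d⟩⟩ := σ
  rw [pauli_apply] at h
  simp only [Prod.ext_iff, Complex.ext_iff, Prod.smul_mk, real_smul, add_re, add_im, sub_re, sub_im,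
    mul_re, mul_im, ofReal_re, ofReal_im, I_re, I_im] at h
  obtain ⟨⟨h1, h2⟩, h3, h4⟩ := h
  ext i
  fin_cases i <;>
    simp only [spinorNormSq, spinorAxis, normSq_apply, Pi.smul_apply, smul_eq_mul, Fin.zero_eta,
      Fin.mk_one, Fin.reduceFinMk, Matrix.cons_val, mul_re, mul_im, conj_re, conj_im]
  · linear_combination c * h1 + d * h2 + a * h3 + b * h4
  · linear_combination c * h2 - d * h1 + b * h3 - a * h4
  · linear_combination a * h1 + b * h2 - c * h3 - d * h4

lemma cross_planeComb (a b : ℂ) (x : (Fin 3 → ℝ) × (Fin 3 → ℝ)) :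
    planeComb a x ⨯₃ planeComb b x = (conj a * b).im • x.1 ⨯₃ x.2 := by
  ext i
  fin_cases i <;> simp [cross_apply, planeComb] <;> ring

lemma isSpinor_planeComb {σ : ℂ × ℂ} {x : (Fin 3 → ℝ) × (Fin 3 → ℝ)} (h : IsSpinor σ x) {a b : ℂ}
    (hab : 0 ≤ (conj a * b).im) : IsSpinor σ (planeComb a x, planeComb b x) := by
  refine ⟨h.1, ?_⟩
  rw [cross_planeComb, map_smul, _root_.smul_apply, h.2, smul_smul, smul_dotProduct,
    dotProduct_smul, smul_eq_mul, smul_eq_mul, ← mul_assoc, Real.sqrt_mul (mul_self_nonneg _),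
    Real.sqrt_mul_self hab]

lemma isSpinor_rotatePair {σ : ℂ × ℂ} {x : (Fin 3 → ℝ) × (Fin 3 → ℝ)} (h : IsSpinor σ x) (u : ℂ) :
    IsSpinor σ (rotatePair u x) :=
  isSpinor_planeComb h <| by
    rw [mul_left_comm, ← normSq_eq_conj_mul_self]
    simpa using normSq_nonneg u

lemma isSpinor_spinorPair {σ : ℂ × ℂ} (h : σ ≠ 0) : IsSpinor σ (spinorPair σ) := by
  refine ⟨h, ?_⟩
  have hN := (spinorNormSq_pos h).le
  rw [cross_spinorPair, map_smul, _root_.smul_apply, pauli_spinorAxis, smul_smul,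
    smul_dotProduct, dotProduct_smul, dotProduct_spinorAxis_self]
  rw [show spinorNormSq σ • spinorNormSq σ • spinorNormSq σ ^ 2 =
    (spinorNormSq σ * spinorNormSq σ) ^ 2 by simp only [smul_eq_mul]; ring,
    Real.sqrt_sq (mul_nonneg hN hN)]

lemma spinorPair_mem {σ : ℂ × ℂ} (h : σ ≠ 0) : spinorPair σ ∈ independentPairs := by
  have hN := spinorNormSq_pos h
  refine crossProduct_ne_zero_iff_linearIndependent.1 fun h0 => ?_
  have := congrArg (fun v => v ⬝ᵥ v) h0
  simp [cross_spinorPair, dotProduct_spinorAxis_self, hN.ne'] at this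

lemma exists_isSpinor {x : (Fin 3 → ℝ) × (Fin 3 → ℝ)} (hx : x ∈ independentPairs) :
    ∃ σ, IsSpinor σ x := by
  have hn := dotProduct_cross_self_pos hx
  set n := x.1 ⨯₃ x.2
  have hr : 0 < √(n ⬝ᵥ n) := Real.sqrt_pos.2 hn
  have hfix (e : ℂ × ℂ) : pauli n (√(n ⬝ᵥ n) • e + pauli n e) =
      √(n ⬝ᵥ n) • (√(n ⬝ᵥ n) • e + pauli n e) := by
    rw [map_add, map_smul, pauli_pauli, smul_add, smul_smul, Real.mul_self_sqrt hn.le, add_comm]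
  by_contra! hnot
  have hzero (e : ℂ × ℂ) : √(n ⬝ᵥ n) • e + pauli n e = 0 := by
    by_contra he
    exact hnot _ ⟨he, hfix e⟩
  have h1 : √(n ⬝ᵥ n) + n 2 = 0 := by
    simpa [pauli_apply] using congrArg (fun v => v.1.re) (hzero (1, 0))
  have h2 : √(n ⬝ᵥ n) + -n 2 = 0 := by
    simpa [pauli_apply] using congrArg (fun v => v.2.re) (hzero (0, 1))
  linarith

lemma IsSpinor.eq_spinorRatio_smul {σ τ : ℂ × ℂ} {x : (Fin 3 → ℝ) × (Fin 3 → ℝ)}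
    (hσ : IsSpinor σ x) (hτ : IsSpinor τ x) (hx : x ∈ independentPairs) :
    τ = spinorRatio σ τ • σ := by
  have hr := Real.sqrt_pos.2 (dotProduct_cross_self_pos hx)
  have hN := spinorNormSq_pos hσ.1
  have hτ' : pauli (spinorAxis σ) τ = spinorNormSq σ • τ := by
    refine smul_right_injective _ hr.ne' ?_
    simp only
    rw [← _root_.smul_apply, ← map_smul, ← smul_eq_smul_spinorAxis hσ.2, map_smul,
      _root_.smul_apply, hτ.2, smul_comm]
  have h := spinorNormSq_smul_add_pauli σ τ
  have hratio : 2 * (conj σ.1 * τ.1 + conj σ.2 * τ.2) =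
      (2 * spinorNormSq σ : ℝ) * spinorRatio σ τ := by
    have : (spinorNormSq σ : ℂ) ≠ 0 := ofReal_ne_zero.2 hN.ne'
    rw [spinorRatio]
    push_cast
    field_simp
  rw [hτ', ← two_smul ℝ, hratio, mul_smul, coe_smul, smul_smul] at h
  exact smul_right_injective _ (mul_pos two_pos hN).ne' h

/-- The complex coordinate of `v` in the plane with orthogonal basis `spinorPair σ`. -/
def spinorCoord (σ : ℂ × ℂ) (v : Fin 3 → ℝ) : ℂ :=
  (v ⬝ᵥ (spinorPair σ).1 + v ⬝ᵥ (spinorPair σ).2 * I) / (spinorNormSq σ ^ 2 : ℝ)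

lemma planeComb_spinorCoord {σ : ℂ × ℂ} (hσ : σ ≠ 0) {v : Fin 3 → ℝ}
    (hv : v ⬝ᵥ spinorAxis σ = 0) : planeComb (spinorCoord σ v) (spinorPair σ) = v := by
  have hN := (pow_pos (spinorNormSq_pos hσ) 2).ne'
  refine smul_right_injective _ hN ?_
  have h := spinorNormSq_sq_smul σ v
  rw [hv, zero_smul, add_zero] at h
  simp only [h, planeComb, spinorCoord, div_ofReal_re, div_ofReal_im, smul_add, smul_smul,
    mul_div_cancel₀ _ hN]
  simp

lemma IsSpinor.eq_planeComb {σ : ℂ × ℂ} {x : (Fin 3 → ℝ) × (Fin 3 → ℝ)} (hσ : IsSpinor σ x)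
    (hx : x ∈ independentPairs) :
    x = (planeComb (spinorCoord σ x.1) (spinorPair σ),
      planeComb (spinorCoord σ x.2) (spinorPair σ)) ∧
      0 < (spinorCoord σ x.2 / spinorCoord σ x.1).im := by
  have hr := Real.sqrt_pos.2 (dotProduct_cross_self_pos hx)
  have hN := spinorNormSq_pos hσ.1
  have haxis := smul_eq_smul_spinorAxis hσ.2
  have horth (v : Fin 3 → ℝ) (hv : v ⬝ᵥ x.1 ⨯₃ x.2 = 0) : v ⬝ᵥ spinorAxis σ = 0 := by
    have := congrArg (v ⬝ᵥ ·) haxis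
    simpa [hv, hr.ne'] using this.symm
  have h1 := planeComb_spinorCoord hσ.1 (horth _ (dot_self_cross x.1 x.2))
  have h2 := planeComb_spinorCoord hσ.1 (horth _ (dot_cross_self x.1 x.2))
  refine ⟨(Prod.ext h1 h2).symm, ?_⟩
  have hcross : x.1 ⨯₃ x.2 = (conj (spinorCoord σ x.1) * spinorCoord σ x.2).im •
      spinorNormSq σ • spinorAxis σ := by
    rw [← cross_spinorPair, ← cross_planeComb, h1, h2]
  generalize √((x.1 ⨯₃ x.2) ⬝ᵥ (x.1 ⨯₃ x.2)) = r at hr haxis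
  rw [hcross] at haxis
  have hdot := congrArg (· ⬝ᵥ spinorAxis σ) haxis
  simp only [smul_dotProduct, dotProduct_spinorAxis_self, smul_eq_mul] at hdot
  rw [im_div_eq]
  have him : 0 < (conj (spinorCoord σ x.1) * spinorCoord σ x.2).im := by
    by_contra! hle
    nlinarith [mul_pos hr (pow_pos hN 2), mul_nonneg (neg_nonneg.2 hle) (pow_pos hN 4).le]
  refine div_pos him (normSq_pos.2 fun h0 => ?_)
  simp [h0] at him

lemma continuous_planeComb {M : Type*} [AddCommGroup M] [Module ℝ M] [TopologicalSpace M]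
    [ContinuousAdd M] [ContinuousSMul ℝ M] :
    Continuous fun p : ℂ × M × M => planeComb p.1 p.2 := by
  unfold planeComb
  fun_prop

lemma continuous_spinorPair : Continuous spinorPair := by
  unfold spinorPair
  fun_prop

lemma continuous_spinorNormSq : Continuous spinorNormSq :=
  (continuous_normSq.comp continuous_fst).add (continuous_normSq.comp continuous_snd)

lemma continuousOn_spinorCoord {X : Type*} [TopologicalSpace X] {S : Set X} {σ : X → ℂ × ℂ}
    {v : X → Fin 3 → ℝ} (hσ : ContinuousOn σ S) (hv : ContinuousOn v S) (h0 : ∀ x ∈ S, σ x ≠ 0) :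
    ContinuousOn (fun x => spinorCoord (σ x) (v x)) S := by
  have := continuous_spinorPair.comp_continuousOn hσ
  refine .div ?_ (continuous_ofReal.comp_continuousOn
    ((continuous_spinorNormSq.comp_continuousOn hσ).pow 2)) fun x hx => ofReal_ne_zero.2
      (pow_ne_zero 2 (spinorNormSq_pos (h0 x hx)).ne')
  simp only [dotProduct]
  fun_prop

lemma continuousOn_spinorRatio {X : Type*} [TopologicalSpace X] {S : Set X} {σ τ : X → ℂ × ℂ}
    (hσ : ContinuousOn σ S) (hτ : ContinuousOn τ S) (h0 : ∀ x ∈ S, σ x ≠ 0) :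
    ContinuousOn (fun x => spinorRatio (σ x) (τ x)) S := by
  refine .div ?_ (continuous_ofReal.comp_continuousOn
    (continuous_spinorNormSq.comp_continuousOn hσ)) fun x hx => ofReal_ne_zero.2
      (spinorNormSq_pos (h0 x hx)).ne'
  fun_prop

/-- The projection of `ℂ²` onto the spinors of the planes with normal vector `n`. -/
def spinorProjection (n : Fin 3 → ℝ) : ℂ × ℂ →L[ℝ] ℂ × ℂ :=
  (1 / 2 : ℝ) • (.id ℝ (ℂ × ℂ) + (√(n ⬝ᵥ n))⁻¹ • pauli n)

lemma spinorProjection_apply_eq_iff {n : Fin 3 → ℝ} (hn : 0 < n ⬝ᵥ n) {σ : ℂ × ℂ} :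
    spinorProjection n σ = σ ↔ pauli n σ = √(n ⬝ᵥ n) • σ := by
  have hr := (Real.sqrt_pos.2 hn).ne'
  rw [← inv_smul_eq_iff₀ hr, spinorProjection]
  simp only [_root_.smul_apply, _root_.add_apply, ContinuousLinearMap.id_apply]
  constructor <;> intro h
  · linear_combination (norm := module) (2 : ℝ) • h
  · rw [h]
    module

lemma isIdempotentElem_spinorProjection {n : Fin 3 → ℝ} (hn : 0 < n ⬝ᵥ n) :
    IsIdempotentElem (spinorProjection n) := by
  have hr := (Real.sqrt_pos.2 hn).ne'
  refine ContinuousLinearMap.ext fun σ => (spinorProjection_apply_eq_iff hn).2 ?_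
  rw [ContinuousLinearMap.coe_coe]
  simp only [spinorProjection, _root_.smul_apply, _root_.add_apply, ContinuousLinearMap.id_apply,
    map_smul, map_add, pauli_pauli]
  rw [smul_comm √(n ⬝ᵥ n) (1 / 2 : ℝ), smul_add √(n ⬝ᵥ n), smul_inv_smul₀ hr, smul_smul,
    inv_mul_eq_div, Real.div_sqrt, add_comm]

lemma continuousOn_spinorProjection {X : Type*} [TopologicalSpace X] {S : Set X}
    {n : X → Fin 3 → ℝ} (hn : ContinuousOn n S) (h0 : ∀ x ∈ S, 0 < n x ⬝ᵥ n x) :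
    ContinuousOn (fun x => spinorProjection (n x)) S := by
  have hdot : ContinuousOn (fun x => n x ⬝ᵥ n x) S := by
    simp only [dotProduct]
    fun_prop
  have hinv : ContinuousOn (fun x => (√(n x ⬝ᵥ n x))⁻¹) S :=
    hdot.sqrt.inv₀ fun x hx => (Real.sqrt_pos.2 (h0 x hx)).ne'
  exact continuousOn_const (c := (1 / 2 : ℝ)).smul
    (continuousOn_const.add (hinv.smul (pauli.continuous.comp_continuousOn hn)))

theorem exists_continuousOn_isSpinor {V : Type*} [NormedAddCommGroup V] [NormedSpace ℝ V]
    {S : Set V} (hSc : IsCompact S) (hS : StarConvex ℝ 0 S) (h0 : (0 : V) ∈ S)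
    {F : V → (Fin 3 → ℝ) × (Fin 3 → ℝ)} (hF : ContinuousOn F S)
    (hFS : Set.MapsTo F S independentPairs) :
    ∃ σ : V → ℂ × ℂ, ContinuousOn σ S ∧ ∀ z ∈ S, IsSpinor (σ z) (F z) := by
  have hpos (z) (hz : z ∈ S) := dotProduct_cross_self_pos (hFS hz)
  have hn : ContinuousOn (fun z => (F z).1 ⨯₃ (F z).2) S := by
    simp only [cross_apply]
    fun_prop
  obtain ⟨P, hP, hPQ⟩ := exists_transport_of_isIdempotentElem hSc hS
    (contDiffOn_zero.2 (continuousOn_spinorProjection hn hpos))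
    fun z hz => isIdempotentElem_spinorProjection (hpos z hz)
  obtain ⟨σ₀, hσ₀⟩ := exists_isSpinor (hFS h0)
  refine ⟨fun z => P z σ₀, hP.continuousOn.clm_apply continuousOn_const, fun z hz => ⟨fun h => ?_,
    (spinorProjection_apply_eq_iff (hpos z hz)).1 ((hPQ z hz).1 σ₀)⟩⟩
  exact hσ₀.1 ((hPQ z hz).2 σ₀ ((spinorProjection_apply_eq_iff (hpos 0 h0)).2 hσ₀.2) h)

theorem exists_loop_isSpinor (α : C(Circle, independentPairs)) :
    ∃ σ : C(Circle, ℂ × ℂ), ∀ z, IsSpinor (σ z) (α z) := by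
  have hπ : (0 : ℝ) ∈ Set.Icc 0 (2 * Real.pi) := ⟨le_rfl, Real.two_pi_pos.le⟩
  have hπ' : 2 * Real.pi ∈ Set.Icc 0 (2 * Real.pi) := ⟨Real.two_pi_pos.le, le_rfl⟩
  obtain ⟨σ, hσ, hσα⟩ := exists_continuousOn_isSpinor isCompact_Icc
    ((convex_Icc 0 (2 * Real.pi)).starConvex hπ) hπ
    (F := fun θ => (α (Circle.exp θ) : (Fin 3 → ℝ) × (Fin 3 → ℝ)))
    (by fun_prop) fun θ _ => (α _).2
  have hend : IsSpinor (σ (2 * Real.pi)) (α (Circle.exp 0)) := by simpa using hσα _ hπ'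
  set c := spinorRatio (σ 0) (σ (2 * Real.pi))
  have hratio : σ (2 * Real.pi) = c • σ 0 := (hσα 0 hπ).eq_spinorRatio_smul hend (α _).2
  have hc0 : c ≠ 0 := fun h => hend.1 (by rw [hratio, h, zero_smul])
  obtain ⟨g, hg⟩ := exists_continuous_comp_circleExp
    (f := fun θ => exp (-(θ / (2 * Real.pi)) * log c) • σ θ) (by fun_prop) (by
      simp [hratio, smul_smul, exp_neg, exp_log hc0, hc0])
  refine ⟨g, fun z => ?_⟩
  obtain ⟨θ, hθ, rfl⟩ := exists_mem_Icc_circleExp_eq z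
  rw [hg θ hθ]
  exact (hσα θ hθ).smul (exp_ne_zero _)

/-- The map from nonzero spinors to pairs given by `spinorPair`. -/
def spinorPairMap : C(({0}ᶜ : Set (ℂ × ℂ)), independentPairs) where
  toFun σ := ⟨spinorPair σ, spinorPair_mem σ.2⟩
  continuous_toFun := by
    have := continuous_spinorPair
    fun_prop

lemma rotateLoop_add_self_nullhomotopic (j : ℤ) (σ : C(Circle, ({0}ᶜ : Set (ℂ × ℂ)))) :
    (rotateLoop (j + j) (spinorPairMap.comp σ)).Nullhomotopic := by
  let τ : C(Circle, ({0}ᶜ : Set (ℂ × ℂ))) :=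
    { toFun := fun z => ⟨((z ^ j : Circle) : ℂ) • (σ z : ℂ × ℂ),
        smul_ne_zero (z ^ j).coe_ne_zero (σ z).2⟩
      continuous_toFun := (((contMDiff_coe_zpow (n := 0) j).continuous).smul
        (continuous_subtype_val.comp σ.continuous)).subtype_mk _ }
  have hτ : rotateLoop (j + j) (spinorPairMap.comp σ) = spinorPairMap.comp τ := by
    ext1 z
    refine Subtype.ext ?_
    rw [coe_rotateLoop_apply, _root_.zpow_add, Circle.coe_mul, ← pow_two]
    exact (spinorPair_smul _ _).symm
  rw [hτ]
  refine (nullhomotopic_of_two_lt_finrank ?_ τ).comp_right spinorPairMap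
  simp [Module.finrank_prod]

lemma exists_isSpinor_exp_coord {V : Type*} [NormedAddCommGroup V] [NormedSpace ℝ V] {S : Set V}
    (hSc : IsCompact S) (hS : Convex ℝ S) (h0 : (0 : V) ∈ S)
    {F : V → (Fin 3 → ℝ) × (Fin 3 → ℝ)} (hF : ContinuousOn F S)
    (hFS : Set.MapsTo F S independentPairs) :
    ∃ (τ : V → ℂ × ℂ) (A : S → ℂ), ContinuousOn τ S ∧ Continuous A ∧
      ∀ z (hz : z ∈ S), IsSpinor (τ z) (F z) ∧
        (F z).1 = planeComb (exp (A ⟨z, hz⟩)) (spinorPair (τ z)) := by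
  obtain ⟨τ, hτ, hτF⟩ := exists_continuousOn_isSpinor hSc (hS.starConvex h0) h0 hF hFS
  have : ContractibleSpace S := hS.contractibleSpace ⟨0, h0⟩
  obtain ⟨A, hA, hAa⟩ := exists_exp_eq_of_contractibleSpace
    (u := fun z : S => spinorCoord (τ z) (F z).1)
    (continuousOn_iff_continuous_domRestrict.1
      (continuousOn_spinorCoord hτ hF.fst fun z hz => (hτF z hz).1))
    fun z h => by simpa [h] using ((hτF z z.2).eq_planeComb (hFS z.2)).2
  exact ⟨τ, A, hτ, hA, fun z hz => ⟨hτF z hz, by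
    rw [hAa]
    exact congrArg Prod.fst ((hτF z hz).eq_planeComb (hFS hz)).1⟩⟩

theorem even_of_rotateLoop_nullhomotopic {k : ℤ} {σ : C(Circle, ({0}ᶜ : Set (ℂ × ℂ)))}
    (h : (rotateLoop k (spinorPairMap.comp σ)).Nullhomotopic) : Even k := by
  obtain ⟨F, hF, hFS, hFσ⟩ := (nullhomotopic_iff_exists_extension _).1 h
  obtain ⟨τ, A, hτ, hA, hτF⟩ := exists_isSpinor_exp_coord (isCompact_closedBall 0 1)
    (convex_closedBall 0 1) (Metric.mem_closedBall_self zero_le_one) hF hFS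
  let c (z : Circle) : ℂ := spinorRatio (σ z) (τ z)
  have hc : Continuous c := continuousOn_univ.1 <| continuousOn_spinorRatio (by fun_prop)
    (hτ.comp (by fun_prop) fun z _ => coe_mem_disk z) fun z _ => (σ z).2
  have hτc (z : Circle) : τ z = c z • (σ z : ℂ × ℂ) := by
    have hz := coe_mem_disk z
    refine IsSpinor.eq_spinorRatio_smul (x := F z) ?_ (hτF _ hz).1 (hFS hz)
    rw [hFσ, coe_rotateLoop_apply]
    exact isSpinor_rotatePair (isSpinor_spinorPair (σ z).2) _
  have hzk (z : Circle) : ((z ^ k : Circle) : ℂ) = exp (A ⟨z, coe_mem_disk z⟩) * c z ^ 2 := by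
    refine planeComb_injective (spinorPair_mem (σ z).2) ?_
    simp only
    rw [← planeComb_rotatePair, ← spinorPair_smul, ← hτc, ← (hτF _ (coe_mem_disk z)).2, hFσ,
      coe_rotateLoop_apply]
    rfl
  obtain ⟨e, g, hg⟩ := exists_eq_zpow_mul_exp hc fun z h => (hτF _ (coe_mem_disk z)).1.1 <| by
    rw [hτc, h, zero_smul]
  refine ⟨e, sub_eq_zero.1 (eq_zero_of_zpow_eq_exp (k := k - (e + e))
    (g := fun z => A ⟨z, coe_mem_disk z⟩ + (g z + g z)) (by fun_prop) fun z => ?_)⟩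
  rw [_root_.zpow_sub, ← div_eq_mul_inv, Circle.coe_div, hzk, hg,
    div_eq_iff (Circle.coe_ne_zero _), _root_.zpow_add, Circle.coe_mul, exp_add, exp_add]
  ring

lemma rotateLoop_spinorPairMap_nullhomotopic_iff {k : ℤ} {σ : C(Circle, ({0}ᶜ : Set (ℂ × ℂ)))} :
    (rotateLoop k (spinorPairMap.comp σ)).Nullhomotopic ↔ Even k := by
  refine ⟨even_of_rotateLoop_nullhomotopic, ?_⟩
  rintro ⟨j, rfl⟩
  exact rotateLoop_add_self_nullhomotopic j σ

lemma exists_homotopic_rotateLoop_spinorPairMap (α : C(Circle, independentPairs)) :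
    ∃ (d : ℤ) (σ : C(Circle, ({0}ᶜ : Set (ℂ × ℂ)))),
      α.Homotopic (rotateLoop d (spinorPairMap.comp σ)) := by
  obtain ⟨σ, hσ⟩ := exists_loop_isSpinor α
  have hcoord {v : Circle → Fin 3 → ℝ} (hv : Continuous v) :
      ContMDiff (𝓡 1) 𝓘(ℝ, ℂ) 0 fun z => spinorCoord (σ z) (v z) :=
    contMDiff_zero_iff.2 <| continuousOn_univ.1 <|
      continuousOn_spinorCoord σ.continuous.continuousOn hv.continuousOn fun z _ => (hσ z).1
  have hα (z) := (hσ z).eq_planeComb (α z).2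
  obtain ⟨d, U, W, hU, hW, -, hpos, hUW⟩ := exists_homotopy_zpow
    (hcoord (v := fun z => (α z : (Fin 3 → ℝ) × (Fin 3 → ℝ)).1) (by fun_prop))
    (hcoord (v := fun z => (α z : (Fin 3 → ℝ) × (Fin 3 → ℝ)).2) (by fun_prop)) fun z => (hα z).2
  have hχ : Continuous fun p : unitInterval × Circle => spinorPair (σ p.2) :=
    continuous_spinorPair.comp (by fun_prop)
  refine ⟨d, ⟨fun z => ⟨σ z, (hσ z).1⟩, by fun_prop⟩, ⟨{
    toFun := fun p => ⟨(planeComb (U p) (spinorPair (σ p.2)), planeComb (W p) (spinorPair (σ p.2))),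
      linearIndependent_planeComb (spinorPair_mem (hσ p.2).1) (hpos p).ne'⟩
    continuous_toFun := ((continuous_planeComb.comp (hU.prodMk hχ)).prodMk
      (continuous_planeComb.comp (hW.prodMk hχ))).subtype_mk _
    map_zero_left := fun z => Subtype.ext ?_
    map_one_left := fun z => Subtype.ext ?_ }⟩⟩
  · simp only [(hUW z).1, (hUW z).2.1]
    exact (hα z).1.symm
  · simp only [(hUW z).2.2.1, (hUW z).2.2.2]
    rfl

theorem exists_rotateLoop_nullhomotopic_iff (α : C(Circle, independentPairs)) :
    ∃ d : ℤ, ∀ k, (rotateLoop k α).Nullhomotopic ↔ Even (k + d) := by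
  obtain ⟨d, σ, h⟩ := exists_homotopic_rotateLoop_spinorPairMap α
  refine ⟨d, fun k => ?_⟩
  have hk := rotateLoop_homotopic k h
  rw [rotateLoop_rotateLoop] at hk
  rw [← rotateLoop_spinorPairMap_nullhomotopic_iff (σ := σ)]
  exact exists_congr fun y => ⟨hk.symm.trans, hk.trans⟩

end Parity

section EuclideanComb

variable {ι M : Type*} [Fintype ι] [AddCommGroup M] [Module ℝ M] [TopologicalSpace M]
  [ContinuousAdd M] [ContinuousSMul ℝ M]

/-- The linear map that sends the standard basis of `ℝ^ι` to the family `l`. -/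
def euclideanComb (l : ι → M) : EuclideanSpace ℝ ι →L[ℝ] M :=
  ∑ i, (EuclideanSpace.proj i : EuclideanSpace ℝ ι →L[ℝ] ℝ).smulRight (l i)

lemma euclideanComb_apply (l : ι → M) (c : EuclideanSpace ℝ ι) :
    euclideanComb l c = ∑ i, c i • l i := by
  simp [euclideanComb]

lemma euclideanComb_injective {l : ι → M} (hl : LinearIndependent ℝ l) :
    Function.Injective (euclideanComb l) := by
  refine (injective_iff_map_eq_zero _).2 fun c hc => ?_
  rw [euclideanComb_apply] at hc
  ext i
  exact Fintype.linearIndependent_iff.1 hl _ hc i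

lemma range_euclideanComb (l : ι → M) :
    (euclideanComb l).range = Submodule.span ℝ (Set.range l) := by
  ext x
  simp only [Submodule.mem_span_range_iff_exists_fun, LinearMap.mem_range,
    ContinuousLinearMap.coe_coe, euclideanComb_apply]
  exact ⟨fun ⟨c, hc⟩ => ⟨c, hc⟩, fun ⟨c, hc⟩ => ⟨WithLp.toLp 2 c, hc⟩⟩

variable {F : Type*} [NormedAddCommGroup F] [NormedSpace ℝ F]

lemma contDiff_euclideanComb {n : WithTop ℕ∞} :
    ContDiff ℝ n (fun l : ι → F => euclideanComb l) := by
  unfold euclideanComb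
  exact ContDiff.sum fun i _ => contDiff_const.smulRight (contDiff_apply ℝ F i)

lemma isInvertible_euclideanComb [FiniteDimensional ℝ F] {l : ι → F}
    (hl : LinearIndependent ℝ l) (hcard : Fintype.card ι = Module.finrank ℝ F) :
    (euclideanComb l).IsInvertible :=
  ⟨(LinearEquiv.ofInjectiveOfFinrankEq (euclideanComb l).toLinearMap (euclideanComb_injective hl)
    (by simpa using hcard)).toContinuousLinearEquiv, by ext; rfl⟩

end EuclideanComb

section Bundle

open Bundle

variable {B : Type*} [TopologicalSpace B] {F : Type*} [NormedAddCommGroup F]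
  {V : B → Type*} [∀ x, TopologicalSpace (V x)] [TopologicalSpace (TotalSpace F V)]
  [FiberBundle F V]

lemma eventually_mem_baseSet {X : Type*} [TopologicalSpace X] {f : X → B} {s : Set X} {x₀ : X}
    (hf : ContinuousWithinAt f s x₀) :
    ∀ᶠ x in 𝓝[s] x₀, f x ∈ (trivializationAt F V (f x₀)).baseSet :=
  hf.eventually ((trivializationAt F V (f x₀)).open_baseSet.mem_nhds
    (FiberBundle.mem_baseSet_trivializationAt' (f x₀)))

variable [NormedSpace ℝ F] [∀ x, AddCommGroup (V x)] [∀ x, Module ℝ (V x)] [VectorBundle ℝ F V]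
  {E : Type*} [NormedAddCommGroup E] [NormedSpace ℝ E] {H : Type*} [TopologicalSpace H]
  {I : ModelWithCorners ℝ E H} [ChartedSpace H B]

lemma exists_sections_spanning_near [ContMDiffVectorBundle ∞ F V I] [FiniteDimensional ℝ E]
    [T2Space B] [IsManifold I ∞ B] {ι : Type*} (b : Module.Basis ι ℝ F) (x₀ : B) :
    ∃ σ : ι → ∀ x, V x,
      (∀ i, ContMDiff I (I.prod 𝓘(ℝ, F)) ∞ fun x => TotalSpace.mk' F x (σ i x)) ∧
      ∀ᶠ x in 𝓝 x₀, Submodule.span ℝ (Set.range fun i => σ i x) = ⊤ := by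
  let e := trivializationAt F V x₀
  have he : e.baseSet ∈ 𝓝 x₀ := e.open_baseSet.mem_nhds
    (FiberBundle.mem_baseSet_trivializationAt' x₀)
  have hframe := e.isLocalFrameOn_localFrame_baseSet I ∞ b
  obtain ⟨χ, -, hχ⟩ := (SmoothBumpFunction.nhds_basis_tsupport (I := I) x₀).mem_iff.1 he
  refine ⟨fun i => ⇑χ • e.localFrame b i, fun i => ContMDiffOn.smul_section_of_tsupport
    χ.contMDiff.contMDiffOn e.open_baseSet hχ (hframe.contMDiffOn i), ?_⟩
  filter_upwards [χ.eventuallyEq_one, he] with x hx hxe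
  simpa [hx] using hframe.generating hxe

variable (I) in
lemma exists_finite_spanning_sections [ContMDiffVectorBundle ∞ F V I] [FiniteDimensional ℝ E]
    [FiniteDimensional ℝ F] [T2Space B] [IsManifold I ∞ B] {K : Set B} (hK : IsCompact K) :
    ∃ (ι : Type) (_ : Fintype ι) (σ : ι → ∀ x, V x),
      (∀ i, ContMDiff I (I.prod 𝓘(ℝ, F)) ∞ fun x => TotalSpace.mk' F x (σ i x)) ∧
      ∀ x ∈ K, Submodule.span ℝ (Set.range fun i => σ i x) = ⊤ := by
  refine hK.induction_on ⟨Empty, inferInstance, fun i => i.elim, fun i => i.elim, by simp⟩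
    ?_ ?_ fun x₀ _ => ?_
  · rintro S T hST ⟨ι, hι, σ, hσ, hspan⟩
    exact ⟨ι, hι, σ, hσ, fun x hx => hspan x (hST hx)⟩
  · rintro S T ⟨ι, _, σ, hσ, hS⟩ ⟨ι', _, σ', hσ', hT⟩
    refine ⟨ι ⊕ ι', inferInstance, fun i => Sum.elim σ σ' i, Sum.forall.2 ⟨hσ, hσ'⟩, ?_⟩
    rintro x (hx | hx)
    · refine top_le_iff.1 ((hS x hx).symm.le.trans (Submodule.span_mono ?_))
      exact Set.range_subset_iff.2 fun i => ⟨Sum.inl i, rfl⟩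
    · refine top_le_iff.1 ((hT x hx).symm.le.trans (Submodule.span_mono ?_))
      exact Set.range_subset_iff.2 fun i => ⟨Sum.inr i, rfl⟩
  · obtain ⟨σ, hσ, hspan⟩ := exists_sections_spanning_near (V := V) (I := I)
      (Module.finBasis ℝ F) x₀
    exact ⟨_, mem_nhdsWithin_of_mem_nhds hspan, _, inferInstance, σ, hσ, fun x hx => hx⟩

end Bundle

section FieldsAlongMaps

open Bundle

variable {B : Type*} [TopologicalSpace B] {F : Type*} [NormedAddCommGroup F] [NormedSpace ℝ F]
  {V : B → Type*} [∀ x, TopologicalSpace (V x)] [TopologicalSpace (TotalSpace F V)]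
  [FiberBundle F V]
  {E : Type*} [NormedAddCommGroup E] [NormedSpace ℝ E] {H : Type*} [TopologicalSpace H]
  {I : ModelWithCorners ℝ E H} [ChartedSpace H B]
  {E' : Type*} [NormedAddCommGroup E'] [NormedSpace ℝ E'] {H' : Type*} [TopologicalSpace H']
  {I' : ModelWithCorners ℝ E' H'} {X : Type*} [TopologicalSpace X] [ChartedSpace H' X]
  {n : WithTop ℕ∞} {f : X → B} {s : Set X} {ι : Type*} [Fintype ι]

lemma contMDiffWithinAt_euclideanComb_trivializationAt {b : ι → ∀ x, V (f x)} {x₀ : X}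
    (hb : ∀ i, ContMDiffWithinAt I' (I.prod 𝓘(ℝ, F)) n
      (fun x => TotalSpace.mk' F (f x) (b i x)) s x₀) :
    ContMDiffWithinAt I' 𝓘(ℝ, EuclideanSpace ℝ ι →L[ℝ] F) n (fun x => euclideanComb fun i =>
      (trivializationAt F V (f x₀) ⟨f x, b i x⟩).2) s x₀ :=
  (contDiff_euclideanComb (ι := ι) (F := F)).contMDiff.contMDiffAt.comp_contMDiffWithinAt x₀
    (contMDiffWithinAt_pi_space.2 fun i => (contMDiffWithinAt_totalSpace.1 (hb i)).2)

variable [∀ x, AddCommGroup (V x)] [∀ x, Module ℝ (V x)] [∀ x, ContinuousAdd (V x)]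
  [∀ x, ContinuousSMul ℝ (V x)] [VectorBundle ℝ F V]

lemma trivializationAt_euclideanComb {x₀ x : B}
    (hx : x ∈ (trivializationAt F V x₀).baseSet) (l : ι → V x) (c : EuclideanSpace ℝ ι) :
    (trivializationAt F V x₀ ⟨x, euclideanComb l c⟩).2 =
      euclideanComb (fun i => (trivializationAt F V x₀ ⟨x, l i⟩).2) c := by
  have := map_sum ((trivializationAt F V x₀).linearEquivAt ℝ x hx) (fun i => c i • l i) Finset.univ
  simp only [map_smul] at this
  rw [euclideanComb_apply, euclideanComb_apply]
  exact this

lemma contMDiffOn_euclideanComb_field {b : ι → ∀ x, V (f x)} {c : X → EuclideanSpace ℝ ι}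
    (hf : ContMDiffOn I' I n f s)
    (hb : ∀ i, ContMDiffOn I' (I.prod 𝓘(ℝ, F)) n (fun x => TotalSpace.mk' F (f x) (b i x)) s)
    (hc : ContMDiffOn I' 𝓘(ℝ, EuclideanSpace ℝ ι) n c s) :
    ContMDiffOn I' (I.prod 𝓘(ℝ, F)) n
      (fun x => TotalSpace.mk' F (f x) (euclideanComb (fun i => b i x) (c x))) s := by
  intro x₀ hx₀
  refine contMDiffWithinAt_totalSpace.2 ⟨hf x₀ hx₀, ?_⟩
  refine ((contMDiffWithinAt_euclideanComb_trivializationAt fun i => hb i x₀ hx₀).clm_apply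
    (hc x₀ hx₀)).congr_of_eventuallyEq_of_mem ?_ hx₀
  filter_upwards [eventually_mem_baseSet (V := V) (F := F) (hf x₀ hx₀).continuousWithinAt] with x hx
  exact trivializationAt_euclideanComb hx _ _

lemma exists_contMDiffOn_coeff [FiniteDimensional ℝ F] {b : ι → ∀ x, V (f x)} {v : ∀ x, V (f x)}
    (hb : ∀ i, ContMDiffOn I' (I.prod 𝓘(ℝ, F)) n (fun x => TotalSpace.mk' F (f x) (b i x)) s)
    (hli : ∀ x ∈ s, LinearIndependent ℝ (fun i => b i x))
    (hcard : Fintype.card ι = Module.finrank ℝ F)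
    (hv : ContMDiffOn I' (I.prod 𝓘(ℝ, F)) n (fun x => TotalSpace.mk' F (f x) (v x)) s) :
    ∃ c : X → EuclideanSpace ℝ ι, ContMDiffOn I' 𝓘(ℝ, EuclideanSpace ℝ ι) n c s ∧
      ∀ x ∈ s, euclideanComb (fun i => b i x) (c x) = v x := by
  have hinv : ∀ (x₀ : X) (x), x ∈ s → f x ∈ (trivializationAt F V (f x₀)).baseSet →
      (euclideanComb fun i => (trivializationAt F V (f x₀) ⟨f x, b i x⟩).2).IsInvertible :=
    fun x₀ x hx hxe => isInvertible_euclideanComb ((hli x hx).map' _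
      ((trivializationAt F V (f x₀)).linearEquivAt ℝ (f x) hxe).ker) hcard
  have hex : ∀ x, ∃ c : EuclideanSpace ℝ ι, x ∈ s → euclideanComb (fun i => b i x) c = v x := by
    intro x
    by_cases hx : x ∈ s
    · have hxe := FiberBundle.mem_baseSet_trivializationAt' (F := F) (E := V) (f x)
      obtain ⟨c, hc⟩ := (hinv x x hx hxe).bijective.2 (trivializationAt F V (f x) ⟨f x, v x⟩).2
      refine ⟨c, fun _ => ((trivializationAt F V (f x)).linearEquivAt ℝ (f x) hxe).injective ?_⟩
      exact (trivializationAt_euclideanComb hxe _ _).trans hc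
    · exact ⟨0, fun h => absurd h hx⟩
  choose c hc using hex
  refine ⟨c, fun x₀ hx₀ => ?_, hc⟩
  obtain ⟨hf, hv⟩ := contMDiffWithinAt_totalSpace.1 (hv x₀ hx₀)
  have hmem := eventually_mem_baseSet (V := V) (F := F) hf.continuousWithinAt
  have hA := contMDiffWithinAt_euclideanComb_trivializationAt fun i => hb i x₀ hx₀
  have hA' := ((hinv x₀ x₀ hx₀ (hmem.self_of_nhdsWithin hx₀)).contDiffAt_map_inverse
    (n := n)).contMDiffAt.comp_contMDiffWithinAt x₀ hA
  refine (hA'.clm_apply hv).congr_of_eventuallyEq_of_mem ?_ hx₀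
  filter_upwards [hmem, self_mem_nhdsWithin] with x hxe hx
  simp only [Function.comp_apply]
  rw [← hc x hx, trivializationAt_euclideanComb hxe]
  exact ((hinv x₀ x hx hxe).inverse_apply_self _).symm

lemma exists_contMDiffOn_quotient_coeff [FiniteDimensional ℝ F] {κ : Type*} [Fintype κ]
    {P : ∀ x, Submodule ℝ (V (f x))} {a : κ → ∀ x, V (f x)} {b : ι → ∀ x, V (f x)}
    {v : ∀ x, V (f x)} (haP : ∀ x ∈ s, ∀ j, a j x ∈ P x)
    (ha : ∀ j, ContMDiffOn I' (I.prod 𝓘(ℝ, F)) n (fun x => TotalSpace.mk' F (f x) (a j x)) s)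
    (hb : ∀ i, ContMDiffOn I' (I.prod 𝓘(ℝ, F)) n (fun x => TotalSpace.mk' F (f x) (b i x)) s)
    (hali : ∀ x ∈ s, LinearIndependent ℝ fun j => a j x)
    (hbli : ∀ x ∈ s, LinearIndependent ℝ fun i => (P x).mkQ (b i x))
    (hcard : Fintype.card κ + Fintype.card ι = Module.finrank ℝ F)
    (hv : ContMDiffOn I' (I.prod 𝓘(ℝ, F)) n (fun x => TotalSpace.mk' F (f x) (v x)) s) :
    ∃ c : X → ι → ℝ, ContMDiffOn I' 𝓘(ℝ, ι → ℝ) n c s ∧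
      ∀ x ∈ s, ∑ i, c x i • (P x).mkQ (b i x) = (P x).mkQ (v x) := by
  have hli : ∀ x ∈ s, LinearIndependent ℝ fun k => Sum.elim a b k x := fun x hx => by
    have hP : LinearIndependent ℝ fun j => (⟨a j x, haP x hx j⟩ : P x) :=
      .of_comp (P x).subtype (hali x hx)
    convert! hP.sumElim_of_quotient (fun i => b i x) (hbli x hx) using 1
    exact funext (Sum.rec (fun _ => rfl) fun _ => rfl)
  obtain ⟨c, hc, hcv⟩ := exists_contMDiffOn_coeff (b := Sum.elim a b) (Sum.rec ha hb) hli
    (Fintype.card_sum.trans hcard) hv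
  refine ⟨fun x i => c x (Sum.inr i), contMDiffOn_pi_space.2 fun i =>
    (EuclideanSpace.proj (𝕜 := ℝ) (Sum.inr i)).contMDiff.comp_contMDiffOn hc, fun x hx => ?_⟩
  have ha0 : ∀ j, (P x).mkQ (a j x) = 0 := fun j =>
    (Submodule.Quotient.mk_eq_zero _).2 (haP x hx j)
  simp only [← hcv x hx, euclideanComb_apply, Fintype.sum_sum_type, map_add, map_sum, map_smul,
    Sum.elim_inl, Sum.elim_inr, ha0, smul_zero, Finset.sum_const_zero, zero_add]

end FieldsAlongMaps

section FramesAlongMaps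

open Bundle

variable {B : Type*} [TopologicalSpace B]
  {F : Type*} [NormedAddCommGroup F] [InnerProductSpace ℝ F] [FiniteDimensional ℝ F]
  {V : B → Type*} [∀ x, AddCommGroup (V x)] [∀ x, Module ℝ (V x)] [∀ x, TopologicalSpace (V x)]
  [∀ x, ContinuousAdd (V x)] [∀ x, ContinuousSMul ℝ (V x)]
  [TopologicalSpace (TotalSpace F V)] [FiberBundle F V] [VectorBundle ℝ F V]
  {E : Type*} [NormedAddCommGroup E] [NormedSpace ℝ E] {H : Type*} [TopologicalSpace H]
  {I : ModelWithCorners ℝ E H} [ChartedSpace H B]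
  {U : Type*} [NormedAddCommGroup U] [NormedSpace ℝ U] {f : U → B} {S : Set U}
  {n : WithTop ℕ∞} {ι : Type*} [Fintype ι]

lemma contDiffOn_starProjection_orthogonal_ker {σ : ι → ∀ z, V (f z)}
    (hσ : ∀ i, ContMDiffOn 𝓘(ℝ, U) (I.prod 𝓘(ℝ, F)) n (fun z => TotalSpace.mk' F (f z) (σ i z)) S)
    (hspan : ∀ z ∈ S, Submodule.span ℝ (Set.range fun i => σ i z) = ⊤)
    (hf : ContMDiffOn 𝓘(ℝ, U) I n f S) :
    ContDiffOn ℝ n (fun z => (euclideanComb fun i => σ i z).kerᗮ.starProjection) S := by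
  intro z₀ hz₀
  have hA := contMDiffWithinAt_euclideanComb_trivializationAt fun i => hσ i z₀ hz₀
  refine contDiffWithinAt_starProjection_range hz₀ (contDiffWithinAt_adjoint hA.contDiffWithinAt) ?_
  filter_upwards [eventually_mem_baseSet (V := V) (F := F) (hf z₀ hz₀).continuousWithinAt,
    self_mem_nhdsWithin] with z hze hz
  let e := (trivializationAt F V (f z₀)).linearEquivAt ℝ (f z) hze
  set A := euclideanComb fun i => (trivializationAt F V (f z₀) ⟨f z, σ i z⟩).2
  have hAe : A.toLinearMap = e.toLinearMap ∘ₗ (euclideanComb fun i => σ i z).toLinearMap :=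
    LinearMap.ext fun c => (trivializationAt_euclideanComb hze _ c).symm
  have hrange : A.range = ⊤ := by
    rw [hAe, LinearMap.range_comp, range_euclideanComb, hspan z hz, Submodule.map_top, e.range]
  have hker : A.ker = (euclideanComb fun i => σ i z).ker := by
    rw [hAe, LinearEquiv.ker_comp]
  refine ⟨LinearMap.ker_eq_bot.1 ?_, ?_⟩
  · rw [← A.orthogonal_range, hrange, Submodule.top_orthogonal_eq_bot]
  · rw [← hker, A.orthogonal_ker]
    exact Submodule.closed_of_finiteDimensional _ |>.submodule_topologicalClosure_eq

lemma finrank_orthogonal_ker {N : Type*} [AddCommGroup N] [Module ℝ N]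
    {L : EuclideanSpace ℝ ι →ₗ[ℝ] N} (hL : L.range = ⊤) :
    Module.finrank ℝ L.kerᗮ = Module.finrank ℝ N := by
  have h1 := L.finrank_range_add_finrank_ker
  have h2 := L.ker.finrank_add_finrank_orthogonal
  rw [hL, finrank_top] at h1
  omega

variable [T2Space B] [ContMDiffVectorBundle ∞ F V I] [FiniteDimensional ℝ E] [IsManifold I ∞ B]

/-- The pulled-back bundle is a quotient of a trivial bundle; the orthogonal complement of the
kernel is a bundle of subspaces of a fixed Euclidean space, which parallel transport along rays
trivializes. -/
theorem exists_contMDiffOn_frame (hSc : IsCompact S) (hS : StarConvex ℝ 0 S) (h0 : 0 ∈ S)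
    (hf : ContMDiffOn 𝓘(ℝ, U) I ∞ f S) {m : ℕ} (hm : Module.finrank ℝ F = m) :
    ∃ b : Fin m → ∀ z, V (f z), (∀ i, ContMDiffOn 𝓘(ℝ, U) (I.prod 𝓘(ℝ, F)) ∞
      (fun z => TotalSpace.mk' F (f z) (b i z)) S) ∧
      ∀ z ∈ S, LinearIndependent ℝ (fun i => b i z) := by
  obtain ⟨ι, _, σ, hσ, hspan⟩ := exists_finite_spanning_sections (V := V) (F := F) I
    (hSc.image_of_continuousOn hf.continuousOn)
  have hσf : ∀ i, ContMDiffOn 𝓘(ℝ, U) (I.prod 𝓘(ℝ, F)) ∞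
      (fun z => TotalSpace.mk' F (f z) (σ i (f z))) S := fun i => (hσ i).comp_contMDiffOn hf
  have hspanf : ∀ z ∈ S, Submodule.span ℝ (Set.range fun i => σ i (f z)) = ⊤ :=
    fun z hz => hspan _ (Set.mem_image_of_mem f hz)
  have hdim : Module.finrank ℝ (euclideanComb fun i => σ i (f 0)).kerᗮ = m := by
    rw [finrank_orthogonal_ker ((range_euclideanComb _).trans (hspanf 0 h0)), ← hm]
    exact ((trivializationAt F V (f 0)).linearEquivAt ℝ (f 0)
      (FiberBundle.mem_baseSet_trivializationAt' (f 0))).finrank_eq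
  obtain ⟨c, hc, hcK⟩ := exists_contDiffOn_frame hSc hS
    (contDiffOn_starProjection_orthogonal_ker hσf hspanf hf) hdim
  refine ⟨fun i z => euclideanComb (fun j => σ j (f z)) (c i z),
    fun i => contMDiffOn_euclideanComb_field hf hσf (hc i).contMDiffOn, fun z hz => ?_⟩
  obtain ⟨hmem, hli⟩ := hcK z hz
  refine hli.map ((Submodule.orthogonal_disjoint _).symm.mono_left ?_)
  exact Submodule.span_le.2 (Set.range_subset_iff.2 hmem)

theorem exists_complementary_frame (hSc : IsCompact S) (hS : StarConvex ℝ 0 S) (h0 : 0 ∈ S)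
    (hf : ContMDiffOn 𝓘(ℝ, U) I ∞ f S) {k m : ℕ} (hm : Module.finrank ℝ F = k + m)
    {w : Fin k → ∀ z, V (f z)} (hw : ∀ i, ContMDiffOn 𝓘(ℝ, U) (I.prod 𝓘(ℝ, F)) ∞
      (fun z => TotalSpace.mk' F (f z) (w i z)) S)
    (hwi : ∀ z ∈ S, LinearIndependent ℝ (fun i => w i z)) :
    ∃ N : Fin m → ∀ z, V (f z), (∀ i, ContMDiffOn 𝓘(ℝ, U) (I.prod 𝓘(ℝ, F)) ∞
      (fun z => TotalSpace.mk' F (f z) (N i z)) S) ∧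
      ∀ z ∈ S, LinearIndependent ℝ (Sum.elim (fun i => w i z) fun i => N i z) := by
  obtain ⟨b, hb, hbi⟩ := exists_contMDiffOn_frame (V := V) hSc hS h0 hf hm
  choose a ha hab using fun i =>
    exists_contMDiffOn_coeff hb hbi (by simp [hm]) (hw i)
  have hai : ∀ z ∈ S, LinearIndependent ℝ (fun i => a i z) := fun z hz =>
    LinearIndependent.of_comp (euclideanComb fun i => b i z).toLinearMap
      (by simpa [Function.comp_def, hab _ z hz] using hwi z hz)
  let K : U → Submodule ℝ (EuclideanSpace ℝ (Fin (k + m))) :=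
    fun z => Submodule.span ℝ (Set.range fun i => a i z)
  have hK : ContDiffOn ℝ ∞ (fun z => (K z)ᗮ.starProjection) S := fun z₀ hz₀ =>
    contDiffWithinAt_starProjection_orthogonal <| contDiffWithinAt_starProjection_range hz₀
      (contDiff_euclideanComb.comp_contDiffWithinAt
        (contDiffWithinAt_pi.2 fun i => (ha i z₀ hz₀).contDiffWithinAt))
      (Filter.eventually_of_mem self_mem_nhdsWithin fun z hz =>
        ⟨euclideanComb_injective (hai z hz), (range_euclideanComb _).symm⟩)
  have hdim : Module.finrank ℝ (K 0)ᗮ = m := by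
    have h1 := (K 0).finrank_add_finrank_orthogonal
    have h2 : Module.finrank ℝ (K 0) = k := by simpa using finrank_span_eq_card (hai 0 h0)
    rw [finrank_euclideanSpace, Fintype.card_fin] at h1
    omega
  obtain ⟨c, hc, hcK⟩ := exists_contDiffOn_frame hSc hS hK hdim
  refine ⟨fun i z => euclideanComb (fun j => b j z) (c i z),
    fun i => contMDiffOn_euclideanComb_field hf hb (hc i).contMDiffOn, fun z hz => ?_⟩
  obtain ⟨hmem, hli⟩ := hcK z hz
  have hdisj := (K z).orthogonal_disjoint.mono_right
    (Submodule.span_le.2 (Set.range_subset_iff.2 hmem))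
  have heq : Sum.elim (fun i => w i z) (fun i => euclideanComb (fun j => b j z) (c i z)) =
      (euclideanComb fun j => b j z) ∘ Sum.elim (fun i => a i z) (fun i => c i z) :=
    funext (Sum.forall.2 ⟨fun i => (hab i z hz).symm, fun _ => rfl⟩)
  rw [heq]
  exact ((hai z hz).sum_type hli hdisj).map' _
    (LinearMap.ker_eq_bot.2 (euclideanComb_injective (hbi z hz)))

end FramesAlongMaps

section Immersion

variable {E F : Type*} [NormedAddCommGroup E] [NormedSpace ℝ E] [NormedAddCommGroup F]
  [NormedSpace ℝ F] {H G : Type*} [TopologicalSpace H] [TopologicalSpace G]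
  {I : ModelWithCorners ℝ E H} {J : ModelWithCorners ℝ F G} {M N : Type*} [TopologicalSpace M]
  [ChartedSpace H M] [TopologicalSpace N] [ChartedSpace G N] {n : WithTop ℕ∞} {f : M → N} {x : M}

lemma exists_comp_eventuallyEq_domChart [IsManifold J 1 N] (h : IsImmersionAt I J n f x)
    (hn : 1 ≤ n) :
    ∃ g : N → E, MDifferentiableAt J 𝓘(ℝ, E) g (f x) ∧ g ∘ f =ᶠ[𝓝 x] I ∘ h.domChart := by
  let A : F →L[ℝ] E := (ContinuousLinearMap.fst ℝ E h.complement).comp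
    h.equiv.symm.toContinuousLinearMap
  have hcod := IsManifold.maximalAtlas_subset_of_le hn h.codChart_mem_maximalAtlas
  refine ⟨A ∘ J ∘ h.codChart, A.mdifferentiableAt.comp (f x) (J.mdifferentiableAt.comp (f x)
    (mdifferentiableAt_of_mem_maximalAtlas hcod h.mem_codChart_source)), ?_⟩
  filter_upwards [h.domChart.open_source.mem_nhds h.mem_domChart_source] with y hy
  have hy' : y ∈ (h.domChart.extend I).source := by rwa [OpenPartialHomeomorph.extend_source]
  have hw := h.writtenInCharts ((h.domChart.extend I).map_source hy')
  simp only [Function.comp_apply, (h.domChart.extend I).left_inv hy'] at hw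
  exact (congrArg A hw).trans (congrArg Prod.fst (h.equiv.symm_apply_apply _))

lemma mfderiv_injective_of_isImmersionAt [IsManifold I 1 M] [IsManifold J 1 N]
    (h : IsImmersionAt I J n f x) (hn : 1 ≤ n) : Function.Injective (mfderiv I J f x) := by
  have hdom := IsManifold.maximalAtlas_subset_of_le hn h.domChart_mem_maximalAtlas
  have hchart : h.domChart.MDifferentiable I I :=
    ⟨fun y hy => (mdifferentiableAt_of_mem_maximalAtlas hdom hy).mdifferentiableWithinAt,
      fun y hy => (mdifferentiableAt_symm_of_mem_maximalAtlas hdom hy).mdifferentiableWithinAt⟩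
  obtain ⟨g, hg, hgf⟩ := exists_comp_eventuallyEq_domChart h hn
  have hf : MDifferentiableAt I J f x := h.contMDiffAt.mdifferentiableAt (by positivity)
  have hinj : Function.Injective (mfderiv I 𝓘(ℝ, E) (I ∘ h.domChart) x) := by
    rw [mfderiv_comp x I.mdifferentiableAt (hchart.mdifferentiableAt h.mem_domChart_source),
      I.hasMFDerivAt.mfderiv]
    exact hchart.mfderiv_injective h.mem_domChart_source
  rw [← hgf.mfderiv_eq, mfderiv_comp x hg hf] at hinj
  exact Function.Injective.of_comp (f := mfderiv J 𝓘(ℝ, E) g (f x)) hinj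

end Immersion

section Velocity

variable {H : Type*} [TopologicalSpace H]
  {J : ModelWithCorners ℝ (EuclideanSpace ℝ (Fin 3)) H}
  {Y : Type*} [TopologicalSpace Y] [ChartedSpace H Y] [IsManifold J 1 Y]

lemma contMDiff_velocity {γ : Circle → Y} (hγ : ContMDiff (𝓡 1) J ∞ γ) :
    ContMDiff (𝓡 1) J.tangent ∞ (fun z => (⟨γ z, velocity J γ z⟩ : TangentBundle J Y)) := by
  intro z₀
  have hLie : LieGroup (𝓡 1) ∞ Circle := LieGroup.of_le (n := ω) le_top
  have hmul : ContMDiff ((𝓡 1).prod 𝓘(ℝ, ℝ)) J ∞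
      (Function.uncurry fun (z : Circle) (t : ℝ) => γ (z * Circle.exp t)) :=
    hγ.comp (contMDiff_fst.mul (contMDiff_circleExp.comp contMDiff_snd))
  have hderiv := ContMDiffAt.mfderiv (x₀ := z₀) (m := ∞) (n := ∞)
    (fun (z : Circle) (t : ℝ) => γ (z * Circle.exp t)) (fun _ => (0 : ℝ)) (hmul _)
    contMDiffAt_const (by simp)
  have hvel := ContMDiffAt.clm_apply_of_inCoordinates (IB₁ := 𝓘(ℝ, ℝ)) (IB₂ := J) (n := ∞)
    (IM := 𝓡 1) (F₁ := ℝ) (F₂ := EuclideanSpace ℝ (Fin 3)) (m₀ := z₀)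
    (E₁ := (TangentSpace 𝓘(ℝ, ℝ) : ℝ → Type _)) (E₂ := (TangentSpace J : Y → Type _))
    (b₁ := fun _ : Circle => (0 : ℝ)) (v := fun _ => (1 : ℝ))
    (b₂ := fun z : Circle => γ (z * Circle.exp 0))
    (ϕ := fun z => mfderiv 𝓘(ℝ, ℝ) J (fun t : ℝ => γ (z * Circle.exp t)) 0)
    hderiv contMDiffAt_const (by simpa using hγ z₀)
  refine hvel.congr_of_eventuallyEq (Filter.Eventually.of_forall fun z => ?_)
  exact congrArg (fun y => (⟨y, (velocity J γ z : EuclideanSpace ℝ (Fin 3))⟩ : TangentBundle J Y))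
    (by simp : γ z = γ (z * Circle.exp 0))

end Velocity

section DiskFrame

variable {G : Type*} [TopologicalSpace G]
  {I : ModelWithCorners ℝ (EuclideanSpace ℝ (Fin 5)) G}
  {W : Type*} [TopologicalSpace W] [ChartedSpace G W] {Δ : ℂ → W} {z : ℂ}

variable (I) in
/-- The `j`-th partial derivative of a disk, for the coordinates of the plane in which the disk is
parametrized. -/
def coordField (Δ : ℂ → W) (j : Fin 2) (z : ℂ) : TangentSpace I (Δ z) :=
  mfderivWithin 𝓘(ℝ, ℂ) I Δ disk z (Complex.basisOneI j : ℂ)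

lemma span_range_map_basis {ι K M N : Type*} [Semiring K] [AddCommMonoid M] [Module K M]
    [AddCommMonoid N] [Module K N] (b : Module.Basis ι K M) (A : M →ₗ[K] N) :
    Submodule.span K (Set.range fun i => A (b i)) = A.range := by
  rw [A.range_eq_map, ← b.span_eq, ← Submodule.span_image, ← Set.range_comp]
  rfl

lemma span_coordField :
    Submodule.span ℝ (Set.range fun j => coordField I Δ j z) = tangentPlane I Δ z :=
  span_range_map_basis (M := ℂ) Complex.basisOneI
    (mfderivWithin 𝓘(ℝ, ℂ) I Δ disk z).toLinearMap

lemma linearIndependent_coordField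
    (h : Function.Injective (mfderivWithin 𝓘(ℝ, ℂ) I Δ disk z)) :
    LinearIndependent ℝ (fun j => coordField I Δ j z) :=
  Complex.basisOneI.linearIndependent.map' (mfderivWithin 𝓘(ℝ, ℂ) I Δ disk z).toLinearMap
    (LinearMap.ker_eq_bot.2 h)

lemma contMDiffOn_coordField [IsManifold I ∞ W] (hΔ : ContMDiffOn 𝓘(ℝ, ℂ) I ∞ Δ disk)
    (j : Fin 2) :
    ContMDiffOn 𝓘(ℝ, ℂ) I.tangent ∞
      (fun z => (⟨Δ z, coordField I Δ j z⟩ : TangentBundle I W)) disk := by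
  have hdisk : UniqueMDiffOn 𝓘(ℝ, ℂ) disk :=
    (uniqueDiffOn_convex (convex_closedBall 0 1) (by
      simp [interior_closedBall (0 : ℂ) one_ne_zero])).uniqueMDiffOn
  have hconst : ContMDiff 𝓘(ℝ, ℂ) 𝓘(ℝ, ℂ).tangent ∞
      (fun z : ℂ => (⟨z, (Complex.basisOneI j : ℂ)⟩ : TangentBundle 𝓘(ℝ, ℂ) ℂ)) := by
    intro z
    refine Bundle.contMDiffAt_totalSpace.2 ⟨contMDiffAt_id, ?_⟩
    simpa only [trivializationAt_model_space_apply] using contMDiffAt_const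
  exact (hΔ.contMDiffOn_tangentMapWithin (m := ∞) (by simp) hdisk).comp
    (hconst.contMDiffOn (s := disk)) fun z hz => hz

end DiskFrame

section Curve

variable {H : Type*} [TopologicalSpace H]
  {J : ModelWithCorners ℝ (EuclideanSpace ℝ (Fin 3)) H}
  {Y : Type*} [TopologicalSpace Y] [ChartedSpace H Y] {γ : Circle → Y}

lemma exists_eq_smul_velocity_add {z : Circle} {v w : TangentSpace J (γ z)}
    (h : (tangentLine J γ z).mkQ v = (tangentLine J γ z).mkQ w) :
    ∃ s : ℝ, v = s • velocity J γ z + w := by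
  obtain ⟨s, hs⟩ := Submodule.mem_span_singleton.1 ((Submodule.Quotient.eq _).1 h)
  exact ⟨s, by rw [hs, sub_add_cancel]⟩

variable [IsManifold J 1 Y] {o : ManifoldOrientation J Y}

namespace Framing

/-- The pair of normal vectors at `γ z` given by a framing. -/
def pair (φ : Framing o γ) (z : Circle) : CurveNormal J γ z × CurveNormal J γ z :=
  (φ.vec 0 z, φ.vec 1 z)

lemma eq_of_pair_eq {φ ψ : Framing o γ} (h : ∀ z, φ.pair z = ψ.pair z) : φ = ψ := by
  ext i z
  fin_cases i
  exacts [congrArg Prod.fst (h z), congrArg Prod.snd (h z)]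

lemma pair_vadd (k : ℤ) (φ : Framing o γ) (z : Circle) :
    (k +ᵥ φ).pair z = rotatePair ((z ^ k : Circle) : ℂ) (φ.pair z) := by
  change (rot (z ^ k) 0 0 • φ.vec 0 z + rot (z ^ k) 0 1 • φ.vec 1 z,
    rot (z ^ k) 1 0 • φ.vec 0 z + rot (z ^ k) 1 1 • φ.vec 1 z) = _
  simp [rot, rotatePair, planeComb, pair]

lemma exists_basis (φ : Framing o γ) (z : Circle) :
    ∃ b : Module.Basis (Fin 3) ℝ (TangentSpace J (γ z)), b 0 = velocity J γ z ∧
      ((tangentLine J γ z).mkQ (b 1), (tangentLine J γ z).mkQ (b 2)) = φ.pair z ∧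
      b.orientation = o.orientationAt (γ z) := by
  obtain ⟨v, hv, b, hb, hbo⟩ := φ.positive z
  exact ⟨b, congrFun hb 0, Prod.ext (congrArg _ (congrFun hb 1) |>.trans (hv 0))
    (congrArg _ (congrFun hb 2) |>.trans (hv 1)), hbo⟩

lemma velocity_ne_zero (φ : Framing o γ) (z : Circle) : velocity J γ z ≠ 0 := by
  obtain ⟨b, hb, -⟩ := φ.exists_basis z
  exact hb ▸ b.ne_zero 0

lemma linearIndependent (φ : Framing o γ) (z : Circle) :
    LinearIndependent ℝ fun i => φ.vec i z := by
  obtain ⟨v, hv, b, hb, -⟩ := φ.positive z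
  have hli := b.linearIndependent
  rw [hb] at hli
  have hvi := linearIndependent_finCons.1 hli
  convert! hvi.1.map (f := (tangentLine J γ z).mkQ) (by
    rw [Submodule.ker_mkQ, Submodule.disjoint_span_singleton' (φ.velocity_ne_zero z)]
    exact hvi.2) using 1
  funext i
  fin_cases i
  exacts [(hv 0).symm, (hv 1).symm]

lemma linearIndependent_pair (φ : Framing o γ) (z : Circle) :
    LinearIndependent ℝ ![(φ.pair z).1, (φ.pair z).2] := by
  convert! φ.linearIndependent z using 1
  funext i
  fin_cases i <;> rfl

/-- The determinant of a change of frame does not depend on the choice of representatives of the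
normal vectors, since the velocity comes first. -/
lemma isPositiveNormalBasis_planeComb (φ : Framing o γ) (z : Circle) (u w : ℂ) :
    IsPositiveNormalBasis o γ z ![planeComb u (φ.pair z), planeComb w (φ.pair z)] ↔
      0 < (w / u).im := by
  obtain ⟨b, hb, hbφ, hbo⟩ := φ.exists_basis z
  have hmk (a : ℂ) : (tangentLine J γ z).mkQ (planeComb a (b 1, b 2)) = planeComb a (φ.pair z) := by
    rw [map_planeComb, hbφ]
  rw [im_div_pos_iff]
  constructor
  · rintro ⟨v, hv, b', hb', hbo'⟩
    obtain ⟨s, hs⟩ := exists_eq_smul_velocity_add ((hv 0).trans (hmk u).symm)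
    obtain ⟨t, ht⟩ := exists_eq_smul_velocity_add ((hv 1).trans (hmk w).symm)
    rw [← det_planeComb b s t, hb, ← hs, ← ht, ← hb',
      ← Module.Basis.orientation_eq_iff_det_pos, hbo, hbo']
  · intro hpos
    have hdet := det_planeComb b 0 0 u w
    rw [zero_smul, zero_add, zero_add] at hdet
    have hbasis := (Module.Basis.is_basis_iff_det b).2 (hdet ▸ hpos.ne'.isUnit)
    refine ⟨![planeComb u (b 1, b 2), planeComb w (b 1, b 2)], fun i => ?_,
      Module.Basis.mk hbasis.1 hbasis.2.ge, by rw [Module.Basis.coe_mk, hb]; rfl, ?_⟩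
    · fin_cases i
      exacts [hmk u, hmk w]
    · rw [← hbo, eq_comm, Module.Basis.orientation_eq_iff_det_pos, Module.Basis.coe_mk, hdet]
      exact hpos

lemma exists_coeff (φ : Framing o γ) (hγ : ContMDiff (𝓡 1) J ∞ γ)
    {E' : Type*} [NormedAddCommGroup E'] [NormedSpace ℝ E'] {H' : Type*} [TopologicalSpace H']
    {I' : ModelWithCorners ℝ E' H'} {X : Type*} [TopologicalSpace X] [ChartedSpace H' X]
    {n : WithTop ℕ∞} (hn : n ≤ ∞) {p : X → Circle} (hp : ContMDiff I' (𝓡 1) n p)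
    {v : ∀ x, TangentSpace J (γ (p x))}
    (hv : ContMDiff I' J.tangent n (fun x => (⟨γ (p x), v x⟩ : TangentBundle J Y))) :
    ∃ u : X → ℂ, ContMDiff I' 𝓘(ℝ, ℂ) n u ∧
      ∀ x, planeComb (u x) (φ.pair (p x)) = (tangentLine J γ (p x)).mkQ (v x) := by
  choose l hl hlφ using φ.smooth
  obtain ⟨c, hc, hcv⟩ := exists_contMDiffOn_quotient_coeff (s := Set.univ)
    (P := fun x => tangentLine J γ (p x))
    (a := fun (_ : Unit) x => velocity J γ (p x)) (b := fun i x => l i (p x))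
    (fun x _ _ => Submodule.mem_span_singleton_self _)
    (fun _ => (((contMDiff_velocity hγ).of_le hn).comp hp).contMDiffOn)
    (fun i => (((hl i).of_le hn).comp hp).contMDiffOn)
    (fun x _ => LinearIndependent.of_subsingleton () (φ.velocity_ne_zero (p x)))
    (fun x _ => by simpa only [hlφ] using φ.linearIndependent (p x))
    (by simp) hv.contMDiffOn
  rw [contMDiffOn_univ] at hc
  refine ⟨fun x => Complex.equivRealProdCLM.symm (c x 0, c x 1), ?_, fun x => ?_⟩
  · exact Complex.equivRealProdCLM.symm.toContinuousLinearMap.contMDiff.comp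
      ((contMDiff_pi_space.1 hc 0).prodMk_space (contMDiff_pi_space.1 hc 1))
  · rw [← hcv x (Set.mem_univ x), Fin.sum_univ_two, hlφ, hlφ]
    rfl

lemma mkQ_planeComb (φ : Framing o γ) {z : Circle} {v : Fin 2 → TangentSpace J (γ z)}
    (hv : ∀ i, (tangentLine J γ z).mkQ (v i) = φ.vec i z) (u : ℂ) :
    (tangentLine J γ z).mkQ (planeComb u (v 0, v 1)) = planeComb u (φ.pair z) := by
  rw [map_planeComb, hv, hv, pair]

lemma isSmoothCurveNormalSection_planeComb (φ : Framing o γ) {u : Circle → ℂ}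
    (hu : ContMDiff (𝓡 1) 𝓘(ℝ, ℂ) ∞ u) :
    IsSmoothCurveNormalSection γ fun z => planeComb (u z) (φ.pair z) := by
  choose l hl hlφ using φ.smooth
  exact ⟨fun z => planeComb (u z) (l 0 z, l 1 z), contMDiff_comb (Complex.reCLM.contMDiff.comp hu)
    (Complex.imCLM.contMDiff.comp hu) (hl 0) (hl 1),
      fun z => φ.mkQ_planeComb (fun i => hlφ i z) (u z)⟩

/-- The framing whose two sections have the coefficients `u` and `w` with respect to `φ`. -/
def combine (φ : Framing o γ) (u w : Circle → ℂ) (hu : ContMDiff (𝓡 1) 𝓘(ℝ, ℂ) ∞ u)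
    (hw : ContMDiff (𝓡 1) 𝓘(ℝ, ℂ) ∞ w) (hpos : ∀ z, 0 < (w z / u z).im) : Framing o γ where
  vec := ![fun z => planeComb (u z) (φ.pair z), fun z => planeComb (w z) (φ.pair z)]
  smooth i := by
    fin_cases i
    exacts [φ.isSmoothCurveNormalSection_planeComb hu, φ.isSmoothCurveNormalSection_planeComb hw]
  positive z := by
    convert! (φ.isPositiveNormalBasis_planeComb z _ _).2 (hpos z) using 1
    funext i
    fin_cases i <;> rfl

lemma homotopic_of_planeComb (φ : Framing o γ) {χ ψ : Framing o γ} {U W : unitInterval × Circle → ℂ}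
    (hU : Continuous U) (hW : Continuous W)
    (hUW : ∀ t, ContMDiff (𝓡 1) 𝓘(ℝ, ℂ) ∞ (fun z => U (t, z)) ∧
      ContMDiff (𝓡 1) 𝓘(ℝ, ℂ) ∞ (fun z => W (t, z)))
    (hpos : ∀ p, 0 < (W p / U p).im)
    (h0 : ∀ z, χ.pair z = (planeComb (U (0, z)) (φ.pair z), planeComb (W (0, z)) (φ.pair z)))
    (h1 : ∀ z, ψ.pair z = (planeComb (U (1, z)) (φ.pair z), planeComb (W (1, z)) (φ.pair z))) :
    Homotopic χ ψ := by
  choose l hl hlφ using φ.smooth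
  have hcomb {u : unitInterval × Circle → ℂ} (hu : Continuous u) :
      Continuous fun p : unitInterval × Circle =>
        (⟨γ p.2, planeComb (u p) (l 0 p.2, l 1 p.2)⟩ : TangentBundle J Y) :=
    continuous_comb (Complex.continuous_re.comp hu) (Complex.continuous_im.comp hu)
      ((hl 0).continuous.comp continuous_snd) ((hl 1).continuous.comp continuous_snd)
  have hmk (z : Circle) := φ.mkQ_planeComb fun i => hlφ i z
  refine ⟨fun t => φ.combine (fun z => U (t, z)) (fun z => W (t, z)) (hUW t).1 (hUW t).2
    fun z => hpos (t, z), eq_of_pair_eq fun z => (h0 z).symm, eq_of_pair_eq fun z => (h1 z).symm,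
    fun i => ?_⟩
  fin_cases i
  exacts [⟨_, hcomb hU, fun t z => hmk z (U (t, z))⟩, ⟨_, hcomb hW, fun t z => hmk z (W (t, z))⟩]

theorem exists_homotopic_vadd (hγ : ContMDiff (𝓡 1) J ∞ γ) (φ ψ : Framing o γ) :
    ∃ k : ℤ, Homotopic ψ (k +ᵥ φ) := by
  choose l hl hlψ using ψ.smooth
  obtain ⟨u, hu, hul⟩ := φ.exists_coeff hγ le_rfl contMDiff_id (hl 0)
  obtain ⟨w, hw, hwl⟩ := φ.exists_coeff hγ le_rfl contMDiff_id (hl 1)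
  have hψ (z : Circle) : ψ.pair z = (planeComb (u z) (φ.pair z), planeComb (w z) (φ.pair z)) :=
    Prod.ext ((hlψ 0 z).symm.trans (hul z).symm) ((hlψ 1 z).symm.trans (hwl z).symm)
  have hpos (z : Circle) : 0 < (w z / u z).im := by
    rw [← φ.isPositiveNormalBasis_planeComb z]
    convert! ψ.positive z using 1
    funext i
    fin_cases i
    exacts [(congrArg Prod.fst (hψ z)).symm, (congrArg Prod.snd (hψ z)).symm]
  obtain ⟨k, U, W, hU, hW, hUW, hUWpos, hend⟩ := exists_homotopy_zpow hu hw hpos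
  refine ⟨k, φ.homotopic_of_planeComb hU hW hUW hUWpos (fun z => ?_) fun z => ?_⟩
  · rw [hψ, (hend z).1, (hend z).2.1]
  · rw [pair_vadd, (hend z).2.2.1, (hend z).2.2.2, rotatePair]

theorem eq_zero_of_homotopic_vadd (hγ : ContMDiff (𝓡 1) J ∞ γ) {φ : Framing o γ} {k : ℤ}
    (h : Homotopic φ (k +ᵥ φ)) : k = 0 := by
  obtain ⟨Φ, h0, h1, h⟩ := h
  obtain ⟨l, hl, hlΦ⟩ := h 0
  obtain ⟨u, hu, hul⟩ := φ.exists_coeff hγ (I' := (𝓡∂ 1).prod (𝓡 1)) (n := 0) (by simp)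
    (contMDiff_zero_iff.2 continuous_snd) (contMDiff_zero_iff.2 hl)
  have huΦ (t : unitInterval) (z : Circle) : planeComb (u (t, z)) (φ.pair z) = (Φ t).vec 0 z :=
    (hul (t, z)).trans (hlΦ t z)
  have hinj (z : Circle) := planeComb_injective (φ.linearIndependent_pair z)
  have hu0 : ∀ p, u p ≠ 0 := fun p hp => ((Φ p.1).linearIndependent p.2).ne_zero 0 <| by
    rw [← huΦ]
    simp [hp, planeComb]
  have hstart (z : Circle) : Complex.exp 0 = u (0, z) := hinj z <| by
    simp only [huΦ, h0]
    simp [planeComb, pair]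
  have hend (z : Circle) : ((z ^ k : Circle) : ℂ) = u (1, z) := hinj z <| by
    simp only [huΦ, h1]
    exact (congrArg Prod.fst (pair_vadd k φ z)).symm
  obtain ⟨g, hg, hgu⟩ := exists_exp_eq_of_homotopy hu.continuous hu0 continuous_const hstart
  exact eq_zero_of_zpow_eq_exp (g := fun z => g (1, z)) (by fun_prop) fun z =>
    (hend z).trans (hgu _).symm

end Framing

end Curve

section DiskNormal

variable {G : Type*} [TopologicalSpace G]
  {I : ModelWithCorners ℝ (EuclideanSpace ℝ (Fin 5)) G}
  {W : Type*} [TopologicalSpace W] [ChartedSpace G W] {Δ : ℂ → W}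

/-- A global frame of the normal bundle of a disk, given by three vector fields along the disk
whose classes form a basis of every fibre. -/
structure IsNormalFrame (N : Fin 3 → ∀ z, TangentSpace I (Δ z)) [IsManifold I 1 W] : Prop where
  smooth : ∀ i, ContMDiffOn 𝓘(ℝ, ℂ) I.tangent ∞
    (fun z => (⟨Δ z, N i z⟩ : TangentBundle I W)) disk
  linearIndependent : ∀ z ∈ disk, LinearIndependent ℝ fun i => (tangentPlane I Δ z).mkQ (N i z)

lemma exists_isNormalFrame [IsManifold I ∞ W] [T2Space W]
    (hΔ : ContMDiffOn 𝓘(ℝ, ℂ) I ∞ Δ disk)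
    (himm : ∀ z ∈ disk, Function.Injective (mfderivWithin 𝓘(ℝ, ℂ) I Δ disk z)) :
    ∃ N : Fin 3 → ∀ z, TangentSpace I (Δ z), IsNormalFrame N := by
  obtain ⟨N, hN, hli⟩ : ∃ N : Fin 3 → ∀ z, TangentSpace I (Δ z), _ ∧ _ :=
    exists_complementary_frame (isCompact_closedBall 0 1)
      ((convex_closedBall 0 1).starConvex (by simp)) (by simp) hΔ (k := 2) (by simp)
      (contMDiffOn_coordField hΔ) fun z hz => linearIndependent_coordField (himm z hz)
  refine ⟨N, hN, fun z hz => ?_⟩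
  obtain ⟨-, hNi, hdisj⟩ := linearIndependent_sum.1 (hli z hz)
  refine hNi.map ?_
  rw [Submodule.ker_mkQ, ← span_coordField]
  exact hdisj.symm

/-- The vector with coordinates `c` in the fibre of `N_W(Δ)` at `Δ z`, relative to the classes of
the fields `N`. -/
def normalComb (N : Fin 3 → ∀ z, TangentSpace I (Δ z)) (z : ℂ) :
    (Fin 3 → ℝ) →ₗ[ℝ] DiskNormal I Δ z :=
  Fintype.linearCombination ℝ fun i => (tangentPlane I Δ z).mkQ (N i z)

namespace IsNormalFrame

variable {N : Fin 3 → ∀ z, TangentSpace I (Δ z)}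

lemma normalComb_injective [IsManifold I 1 W] (hN : IsNormalFrame N) {z : ℂ} (hz : z ∈ disk) :
    Function.Injective (normalComb N z) :=
  (hN.linearIndependent z hz).fintypeLinearCombination_injective

variable [IsManifold I ∞ W]

lemma exists_coeff (hN : IsNormalFrame N) (hΔ : ContMDiffOn 𝓘(ℝ, ℂ) I ∞ Δ disk)
    (himm : ∀ z ∈ disk, Function.Injective (mfderivWithin 𝓘(ℝ, ℂ) I Δ disk z))
    {E' : Type*} [NormedAddCommGroup E'] [NormedSpace ℝ E'] {H' : Type*} [TopologicalSpace H']
    {I' : ModelWithCorners ℝ E' H'} {X : Type*} [TopologicalSpace X] [ChartedSpace H' X]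
    {n : WithTop ℕ∞} (hn : n ≤ ∞) {s : Set X} {p : X → ℂ} (hp : ContMDiffOn I' 𝓘(ℝ, ℂ) n p s)
    (hps : Set.MapsTo p s disk) {v : ∀ x, TangentSpace I (Δ (p x))}
    (hv : ContMDiffOn I' I.tangent n (fun x => (⟨Δ (p x), v x⟩ : TangentBundle I W)) s) :
    ∃ c : X → Fin 3 → ℝ, ContMDiffOn I' 𝓘(ℝ, Fin 3 → ℝ) n c s ∧
      ∀ x ∈ s, normalComb N (p x) (c x) = (tangentPlane I Δ (p x)).mkQ (v x) :=
  exists_contMDiffOn_quotient_coeff (P := fun x => tangentPlane I Δ (p x))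
    (a := fun j x => coordField I Δ j (p x)) (b := fun i x => N i (p x))
    (fun _ _ _ => ⟨_, rfl⟩)
    (fun j => ((contMDiffOn_coordField hΔ j).of_le hn).comp hp hps)
    (fun i => ((hN.smooth i).of_le hn).comp hp hps)
    (fun x hx => linearIndependent_coordField (himm _ (hps hx)))
    (fun x hx => hN.linearIndependent _ (hps hx)) (by simp) hv

lemma isSmoothDiskNormalSectionOn_iff (hN : IsNormalFrame N)
    (hΔ : ContMDiffOn 𝓘(ℝ, ℂ) I ∞ Δ disk)
    (himm : ∀ z ∈ disk, Function.Injective (mfderivWithin 𝓘(ℝ, ℂ) I Δ disk z))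
    {s : ∀ z, DiskNormal I Δ z} :
    IsSmoothDiskNormalSectionOn Δ s disk ↔ ∃ c : ℂ → Fin 3 → ℝ, ContDiffOn ℝ ∞ c disk ∧
      ∀ z ∈ disk, normalComb N z (c z) = s z := by
  constructor
  · rintro ⟨v, hv, hvs⟩
    obtain ⟨c, hc, hcv⟩ :=
      hN.exists_coeff hΔ himm le_rfl (p := id) contMDiffOn_id (Set.mapsTo_id disk) hv
    exact ⟨c, hc.contDiffOn, fun z hz => (hcv z hz).trans (hvs z hz)⟩
  · rintro ⟨c, hc, hcs⟩
    have hc' := (EuclideanSpace.equiv (Fin 3) ℝ).symm.contDiff.comp_contDiffOn hc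
    refine ⟨_, contMDiffOn_euclideanComb_field hΔ hN.smooth hc'.contMDiffOn, fun z hz => ?_⟩
    rw [← hcs z hz, euclideanComb_apply, map_sum]
    simp only [map_smul]
    rfl

end IsNormalFrame

end DiskNormal

section Admissible

variable {H : Type*} [TopologicalSpace H]
  {J : ModelWithCorners ℝ (EuclideanSpace ℝ (Fin 3)) H}
  {Y : Type*} [TopologicalSpace Y] [ChartedSpace H Y]
  {G : Type*} [TopologicalSpace G]
  {I : ModelWithCorners ℝ (EuclideanSpace ℝ (Fin 5)) G}
  {W : Type*} [TopologicalSpace W] [ChartedSpace G W]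
  {ι : Y → W} {γ : Circle → Y} {Δ : ℂ → W}

/-- `Δ` is a smoothly immersed disk in `W` with boundary the curve `γ`, clean along `γ` as in
`IsSpanningDisk`; neither injectivity nor disjointness of the interior from `Y` is required. -/
structure IsImmersedSpanningDisk (J : ModelWithCorners ℝ (EuclideanSpace ℝ (Fin 3)) H)
    (I : ModelWithCorners ℝ (EuclideanSpace ℝ (Fin 5)) G)
    (ι : Y → W) (γ : Circle → Y) (Δ : ℂ → W) : Prop where
  smooth : ContMDiffOn 𝓘(ℝ, ℂ) I ∞ Δ disk
  immersion : ∀ z ∈ disk, Function.Injective (mfderivWithin 𝓘(ℝ, ℂ) I Δ disk z)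
  boundary : ∀ z : Circle, Δ z = ι (γ z)
  clean : ∀ z : Circle,
    ((mfderiv J I ι (γ z)).range : Submodule ℝ (TangentSpace I (Δ z))) ⊓ tangentPlane I Δ z
      = (tangentLine J γ z).map (mfderiv J I ι (γ z)).toLinearMap

lemma IsSpanningDisk.isImmersedSpanningDisk (hΔ : IsSpanningDisk J I ι γ Δ) :
    IsImmersedSpanningDisk J I ι γ Δ :=
  ⟨hΔ.smooth, hΔ.immersion, hΔ.boundary, hΔ.clean⟩

/-- The inclusion of the fibre of `N_Y(γ)` at `γ z` into that of `N_W(Δ)`, induced by the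
differential of `ι`. -/
def normalMap (hΔ : IsImmersedSpanningDisk J I ι γ Δ) (z : Circle) :
    CurveNormal J γ z →ₗ[ℝ] DiskNormal I Δ z :=
  (tangentLine J γ z).mapQ (tangentPlane I Δ z) (mfderiv J I ι (γ z)).toLinearMap
    (Submodule.map_le_iff_le_comap.1 ((hΔ.clean z).symm.le.trans inf_le_right))

lemma normalMap_mkQ (hΔ : IsImmersedSpanningDisk J I ι γ Δ) (z : Circle)
    (v : TangentSpace J (γ z)) :
    normalMap hΔ z ((tangentLine J γ z).mkQ v) =
      (tangentPlane I Δ z).mkQ (mfderiv J I ι (γ z) v) := rfl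

lemma normalMap_injective (hΔ : IsImmersedSpanningDisk J I ι γ Δ) {z : Circle}
    (hι : Function.Injective (mfderiv J I ι (γ z))) : Function.Injective (normalMap hΔ z) := by
  refine (injective_iff_map_eq_zero _).2 fun q hq => ?_
  obtain ⟨v, rfl⟩ := Submodule.mkQ_surjective _ q
  rw [normalMap_mkQ] at hq
  obtain ⟨w, hw, hwv⟩ := (hΔ.clean z).le ⟨⟨v, rfl⟩, (Submodule.Quotient.mk_eq_zero _).1 hq⟩
  exact (Submodule.Quotient.mk_eq_zero _).2 (hι hwv ▸ hw)

variable [IsManifold J ∞ Y] {o : ManifoldOrientation J Y}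

/-- `α` is the loop of coordinates, relative to the normal frame `N` of the disk, of the two
sections of the framing `ψ` of the boundary. -/
def IsCoordinateLoop (hΔ : IsImmersedSpanningDisk J I ι γ Δ)
    (N : Fin 3 → ∀ z, TangentSpace I (Δ z)) (ψ : Framing o γ) (α : C(Circle, independentPairs)) :
    Prop :=
  ∀ z : Circle, Prod.map (normalComb N z) (normalComb N z) (α z) =
    Prod.map (normalMap hΔ z) (normalMap hΔ z) (ψ.pair z)

lemma IsCoordinateLoop.vadd {hΔ : IsImmersedSpanningDisk J I ι γ Δ}
    {N : Fin 3 → ∀ z, TangentSpace I (Δ z)} {φ : Framing o γ} {α : C(Circle, independentPairs)}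
    (hφ : IsCoordinateLoop hΔ N φ α) (k : ℤ) :
    IsCoordinateLoop hΔ N (k +ᵥ φ) (rotateLoop k α) := fun z => by
  rw [coe_rotateLoop_apply, prodMap_rotatePair, hφ z, ← prodMap_rotatePair, Framing.pair_vadd]

variable [IsManifold I ∞ W]

lemma admissible_iff_exists_sections (hΔ : IsImmersedSpanningDisk J I ι γ Δ) (ψ : Framing o γ) :
    Admissible I ι Δ ψ ↔ ∃ Φ : Fin 2 → ∀ z, DiskNormal I Δ z,
      (∀ i, IsSmoothDiskNormalSectionOn Δ (Φ i) disk) ∧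
      (∀ z ∈ disk, LinearIndependent ℝ fun i => Φ i z) ∧
      ∀ (z : Circle) (i : Fin 2), Φ i z = normalMap hΔ z (ψ.vec i z) := by
  constructor
  · rintro ⟨B, -, Φ, ⟨hΦ, hΦB⟩, hbd⟩
    refine ⟨Φ, hΦ, fun z hz => (hΦB z hz).1, fun z i => ?_⟩
    obtain ⟨v, hv⟩ := Submodule.mkQ_surjective _ (ψ.vec i z)
    rw [← hbd z i v hv, ← hv, normalMap_mkQ]
  · rintro ⟨Φ, hΦ, hli, hbd⟩
    have hframe : IsSmoothFrameOn Δ (fun z => Submodule.span ℝ (Set.range fun i => Φ i z)) Φ disk :=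
      ⟨hΦ, fun z hz => ⟨hli z hz, rfl⟩⟩
    refine ⟨_, fun _ _ => ⟨Set.univ, Filter.univ_mem, Φ, by rwa [Set.univ_inter]⟩, Φ, hframe,
      fun z i v hv => ?_⟩
    rw [hbd, ← hv, normalMap_mkQ]

variable {N : Fin 3 → ∀ z, TangentSpace I (Δ z)}

lemma IsNormalFrame.exists_boundary_coeff (hN : IsNormalFrame N)
    (hΔ : IsImmersedSpanningDisk J I ι γ Δ) (hι : ContMDiff J I ∞ ι)
    {E' : Type*} [NormedAddCommGroup E'] [NormedSpace ℝ E'] {H' : Type*} [TopologicalSpace H']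
    {I' : ModelWithCorners ℝ E' H'} {X : Type*} [TopologicalSpace X] [ChartedSpace H' X]
    {n : WithTop ℕ∞} (hn : n ≤ ∞) {p : X → Circle} (hp : ContMDiff I' (𝓡 1) n p)
    {v : ∀ x, TangentSpace J (γ (p x))}
    (hv : ContMDiff I' J.tangent n (fun x => (⟨γ (p x), v x⟩ : TangentBundle J Y))) :
    ∃ c : X → Fin 3 → ℝ, ContMDiff I' 𝓘(ℝ, Fin 3 → ℝ) n c ∧ ∀ x, normalComb N (p x) (c x) =
      normalMap hΔ (p x) ((tangentLine J γ (p x)).mkQ (v x)) := by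
  have hιv := ((hι.contMDiff_tangentMap (m := ∞) (by simp)).of_le hn).comp hv
  have hΔv : ContMDiff I' I.tangent n (fun x => (⟨Δ (p x),
      (mfderiv J I ι (γ (p x)) (v x) : EuclideanSpace ℝ (Fin 5))⟩ : TangentBundle I W)) :=
    hιv.congr fun x => congrArg (fun y => (⟨y,
      (mfderiv J I ι (γ (p x)) (v x) : EuclideanSpace ℝ (Fin 5))⟩ : TangentBundle I W))
      (hΔ.boundary (p x))
  have : Fact (Module.finrank ℝ ℂ = 1 + 1) := finrank_real_complex_fact'
  obtain ⟨c, hc, hcv⟩ := hN.exists_coeff hΔ.smooth hΔ.immersion hn (s := Set.univ)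
    (p := fun x => (p x : ℂ)) (((contMDiff_coe_sphere (E := ℂ) (n := 1)).of_le hn).comp
      hp).contMDiffOn (fun x _ => coe_mem_disk (p x)) hΔv.contMDiffOn
  exact ⟨c, contMDiffOn_univ.1 hc, fun x => hcv x (Set.mem_univ x)⟩

lemma isOpen_independentPairs : IsOpen independentPairs :=
  isOpen_setOfPred_linearIndependent.preimage
    (f := fun x : (Fin 3 → ℝ) × (Fin 3 → ℝ) => ![x.1, x.2]) (by fun_prop)

lemma mem_independentPairs_of_normalComb_eq (hN : IsNormalFrame N)
    (hΔ : IsImmersedSpanningDisk J I ι γ Δ) (ψ : Framing o γ) {z : Circle}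
    (hιz : Function.Injective (mfderiv J I ι (γ z))) {x : (Fin 3 → ℝ) × (Fin 3 → ℝ)}
    (hx : Prod.map (normalComb N z) (normalComb N z) x =
      Prod.map (normalMap hΔ z) (normalMap hΔ z) (ψ.pair z)) : x ∈ independentPairs := by
  change LinearIndependent ℝ ![x.1, x.2]
  rw [← linearIndependent_pair_map_iff (hN.normalComb_injective (coe_mem_disk z)), hx,
    linearIndependent_pair_map_iff (normalMap_injective hΔ hιz)]
  exact ψ.linearIndependent_pair z

lemma exists_isCoordinateLoop (hN : IsNormalFrame N) (hΔ : IsImmersedSpanningDisk J I ι γ Δ)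
    (hι : ContMDiff J I ∞ ι) (hιinj : ∀ z, Function.Injective (mfderiv J I ι (γ z)))
    (ψ : Framing o γ) : ∃ α, IsCoordinateLoop hΔ N ψ α ∧
      ContMDiff (𝓡 1) 𝓘(ℝ, (Fin 3 → ℝ) × (Fin 3 → ℝ)) ∞ fun z => (α z).1 := by
  choose v hv hvψ using ψ.smooth
  choose c hc hcv using fun i =>
    hN.exists_boundary_coeff hΔ hι le_rfl contMDiff_id (hv i)
  have hcψ (z : Circle) : Prod.map (normalComb N z) (normalComb N z) (c 0 z, c 1 z) =
      Prod.map (normalMap hΔ z) (normalMap hΔ z) (ψ.pair z) :=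
    Prod.ext ((hcv 0 z).trans (congrArg _ (hvψ 0 z))) ((hcv 1 z).trans (congrArg _ (hvψ 1 z)))
  have hmem (z : Circle) := mem_independentPairs_of_normalComb_eq hN hΔ ψ (hιinj z) (hcψ z)
  have hcc := (hc 0).prodMk_space (hc 1)
  exact ⟨⟨fun z => ⟨_, hmem z⟩, hcc.continuous.subtype_mk _⟩, hcψ, hcc⟩

namespace IsCoordinateLoop

variable {hΔ : IsImmersedSpanningDisk J I ι γ Δ} {φ ψ : Framing o γ}
  {α β : C(Circle, independentPairs)}

lemma eq_apply (hN : IsNormalFrame N) (hα : IsCoordinateLoop hΔ N ψ α) {z : Circle}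
    {x : (Fin 3 → ℝ) × (Fin 3 → ℝ)} (hx : Prod.map (normalComb N z) (normalComb N z) x =
      Prod.map (normalMap hΔ z) (normalMap hΔ z) (ψ.pair z)) : x = α z :=
  have hinj := hN.normalComb_injective (coe_mem_disk z)
  hinj.prodMap hinj (hx.trans (hα z).symm)

lemma contMDiff (hN : IsNormalFrame N) (hι : ContMDiff J I ∞ ι)
    (hιinj : ∀ z, Function.Injective (mfderiv J I ι (γ z))) (hα : IsCoordinateLoop hΔ N ψ α) :
    ContMDiff (𝓡 1) 𝓘(ℝ, (Fin 3 → ℝ) × (Fin 3 → ℝ)) ∞ fun z => (α z).1 := by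
  obtain ⟨β, hβ, hβs⟩ := exists_isCoordinateLoop hN hΔ hι hιinj ψ
  exact hβs.congr fun z => (hα.eq_apply hN (hβ z)).symm

lemma homotopic (hN : IsNormalFrame N) (hι : ContMDiff J I ∞ ι)
    (hιinj : ∀ z, Function.Injective (mfderiv J I ι (γ z))) (hφ : IsCoordinateLoop hΔ N φ α)
    (hψ : IsCoordinateLoop hΔ N ψ β) (h : Homotopic φ ψ) : α.Homotopic β := by
  obtain ⟨Φ, rfl, rfl, h⟩ := h
  choose v hv hvΦ using h
  choose c hc hcv using fun i => hN.exists_boundary_coeff hΔ hι (I' := (𝓡∂ 1).prod (𝓡 1))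
    (n := 0) (by simp) (contMDiff_zero_iff.2 continuous_snd) (contMDiff_zero_iff.2 (hv i))
  have hcΦ (t : unitInterval) (z : Circle) :
      Prod.map (normalComb N z) (normalComb N z) (c 0 (t, z), c 1 (t, z)) =
        Prod.map (normalMap hΔ z) (normalMap hΔ z) ((Φ t).pair z) :=
    Prod.ext ((hcv 0 (t, z)).trans (congrArg _ (hvΦ 0 t z)))
      ((hcv 1 (t, z)).trans (congrArg _ (hvΦ 1 t z)))
  have hmem (p : unitInterval × Circle) :=
    mem_independentPairs_of_normalComb_eq hN hΔ (Φ p.1) (hιinj p.2) (hcΦ p.1 p.2)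
  exact ⟨⟨⟨fun p => ⟨_, hmem p⟩, ((hc 0).continuous.prodMk (hc 1).continuous).subtype_mk _⟩,
    fun z => Subtype.ext (hφ.eq_apply hN (hcΦ 0 z)),
    fun z => Subtype.ext (hψ.eq_apply hN (hcΦ 1 z))⟩⟩

/-- A nullhomotopy of `α` is an extension of `α` to the disk, which can be smoothed because the
independent pairs form an open set. -/
lemma admissible_iff_nullhomotopic (hN : IsNormalFrame N) (hι : ContMDiff J I ∞ ι)
    (hιinj : ∀ z, Function.Injective (mfderiv J I ι (γ z))) (hα : IsCoordinateLoop hΔ N ψ α) :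
    Admissible I ι Δ ψ ↔ α.Nullhomotopic := by
  rw [admissible_iff_exists_sections hΔ, nullhomotopic_iff_exists_extension]
  constructor
  · rintro ⟨Φ, hΦ, hli, hbd⟩
    choose c hc hcΦ using fun i =>
      (hN.isSmoothDiskNormalSectionOn_iff hΔ.smooth hΔ.immersion).1 (hΦ i)
    have hcΦ' {z : ℂ} (hz : z ∈ disk) :
        Prod.map (normalComb N z) (normalComb N z) (c 0 z, c 1 z) = (Φ 0 z, Φ 1 z) :=
      Prod.ext (hcΦ 0 z hz) (hcΦ 1 z hz)
    refine ⟨fun z => (c 0 z, c 1 z), (hc 0).continuousOn.prodMk (hc 1).continuousOn,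
      fun z hz => ?_, fun z => hα.eq_apply hN ?_⟩
    · change LinearIndependent ℝ ![c 0 z, c 1 z]
      rw [← linearIndependent_pair_map_iff (hN.normalComb_injective hz) (c 0 z, c 1 z), hcΦ' hz]
      convert! hli z hz using 1
      funext i
      fin_cases i <;> rfl
    · rw [hcΦ' (coe_mem_disk z), hbd, hbd]
      rfl
  · rintro ⟨F, hF, hFS, hFα⟩
    obtain ⟨f, hf, hfS, hfα⟩ := exists_contDiff_extension isOpen_independentPairs
      (hα.contMDiff hN hι hιinj) hF hFS hFα
    have hbd (z : Circle) := Prod.ext_iff.1 ((congrArg _ (hfα z)).trans (hα z))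
    refine ⟨![fun z => normalComb N z (f z).1, fun z => normalComb N z (f z).2],
      fun i => (hN.isSmoothDiskNormalSectionOn_iff hΔ.smooth hΔ.immersion).2 ?_,
      fun z hz => ?_, fun z i => ?_⟩
    · fin_cases i
      exacts [⟨_, hf.fst.contDiffOn, fun _ _ => rfl⟩, ⟨_, hf.snd.contDiffOn, fun _ _ => rfl⟩]
    · convert! (linearIndependent_pair_map_iff (hN.normalComb_injective hz) (f z)).2
        (hfS hz) using 1
      funext i
      fin_cases i <;> rfl
    · fin_cases i
      exacts [(hbd z).1, (hbd z).2]

end IsCoordinateLoop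

theorem exists_admissible_vadd_iff [T2Space W] (hι : ContMDiff J I ∞ ι)
    (hιinj : ∀ z, Function.Injective (mfderiv J I ι (γ z)))
    (hΔ : IsImmersedSpanningDisk J I ι γ Δ) (φ : Framing o γ) :
    ∃ d : ℤ, ∀ (k : ℤ) (ψ : Framing o γ), Homotopic ψ (k +ᵥ φ) →
      (Admissible I ι Δ ψ ↔ Even (k + d)) := by
  obtain ⟨N, hN⟩ := exists_isNormalFrame hΔ.smooth hΔ.immersion
  obtain ⟨α, hα, -⟩ := exists_isCoordinateLoop hN hΔ hι hιinj φ
  obtain ⟨d, hd⟩ := exists_rotateLoop_nullhomotopic_iff α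
  refine ⟨d, fun k ψ hψ => ?_⟩
  obtain ⟨β, hβ, -⟩ := exists_isCoordinateLoop hN hΔ hι hιinj ψ
  have h := hβ.homotopic hN hι hιinj (hα.vadd k) hψ
  rw [hβ.admissible_iff_nullhomotopic hN hι hιinj, ← hd k]
  exact ⟨fun ⟨x, hx⟩ => ⟨x, h.symm.trans hx⟩, fun ⟨x, hx⟩ => ⟨x, h.trans hx⟩⟩

end Admissible

namespace FramingClass

variable {H : Type*} [TopologicalSpace H]
  {J : ModelWithCorners ℝ (EuclideanSpace ℝ (Fin 3)) H}
  {Y : Type*} [TopologicalSpace Y] [ChartedSpace H Y] [IsManifold J ∞ Y]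
  {o : ManifoldOrientation J Y} {γ : Circle → Y}

lemma eq_zero_of_vadd_eq (hγ : ContMDiff (𝓡 1) J ∞ γ) {k : ℤ} {c : FramingClass o γ}
    (h : k +ᵥ c = c) : k = 0 := by
  induction c using Quotient.inductionOn with
  | h φ => exact Framing.eq_zero_of_homotopic_vadd hγ (Quotient.exact h).symm

lemma exists_vadd_eq (hγ : ContMDiff (𝓡 1) J ∞ γ) (c d : FramingClass o γ) :
    ∃ k : ℤ, k +ᵥ c = d := by
  induction c, d using Quotient.inductionOn₂ with
  | h φ ψ =>
    obtain ⟨k, hk⟩ := φ.exists_homotopic_vadd hγ ψ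
    exact ⟨k, (Quotient.sound hk).symm⟩

end FramingClass

end

end AmbientSurgery

open AmbientSurgery in
theorem lemma5p3_general
    {G : Type*} [TopologicalSpace G] (I : ModelWithCorners ℝ (EuclideanSpace ℝ (Fin 5)) G)
    {W : Type*} [TopologicalSpace W] [ChartedSpace G W] [IsManifold I ∞ W] [T2Space W]
    {H : Type*} [TopologicalSpace H] (J : ModelWithCorners ℝ (EuclideanSpace ℝ (Fin 3)) H)
    {Y : Type*} [TopologicalSpace Y] [ChartedSpace H Y] [IsManifold J ∞ Y]
    (o : ManifoldOrientation J Y)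
    (γ : Circle → Y) (hγ : ContMDiff (𝓡 1) J ∞ γ)
    (ι : Y → W) (hι : ContMDiff J I ∞ ι)
    (hιγ : ∀ z, Function.Injective (mfderiv J I ι (γ z)))
    (Δ : ℂ → W) (hΔ : IsImmersedSpanningDisk J I ι γ Δ) (φ : Framing o γ) :
    (∀ (k : ℤ) (c : FramingClass o γ), k +ᵥ c = c → k = 0) ∧
    (∀ c d : FramingClass o γ, ∃ k : ℤ, k +ᵥ c = d) ∧
    ((∀ ψ : Framing o γ, Admissible I ι Δ ψ ↔
        ∃ k : ℤ, Even k ∧ ψ.toClass = k +ᵥ φ.toClass) ∨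
      (∀ ψ : Framing o γ, Admissible I ι Δ ψ ↔
        ∃ k : ℤ, Odd k ∧ ψ.toClass = k +ᵥ φ.toClass)) := by
  refine ⟨fun k c => FramingClass.eq_zero_of_vadd_eq hγ, FramingClass.exists_vadd_eq hγ, ?_⟩
  obtain ⟨d, hd⟩ := exists_admissible_vadd_iff hι hιγ hΔ φ
  have hadm (ψ : Framing o γ) :
      Admissible I ι Δ ψ ↔ ∃ k : ℤ, Even (k + d) ∧ ψ.toClass = k +ᵥ φ.toClass := by
    constructor
    · intro hψ
      obtain ⟨k, hk⟩ := φ.exists_homotopic_vadd hγ ψ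
      exact ⟨k, (hd k ψ hk).1 hψ, Quotient.sound hk⟩
    · rintro ⟨k, hk, hψk⟩
      exact (hd k ψ (Quotient.exact hψk)).2 hk
  rcases Int.even_or_odd d with h | h
  · left
    simpa only [Int.even_add, h, iff_true] using hadm
  · right
    simpa only [Int.even_add', h, iff_true] using hadm

theorem lemma5p3
    {G : Type*} [TopologicalSpace G] (I : ModelWithCorners ℝ (EuclideanSpace ℝ (Fin 5)) G)
    {W : Type*} [TopologicalSpace W] [ChartedSpace G W] [IsManifold I ∞ W] [T2Space W]
    {H : Type*} [TopologicalSpace H] (J : ModelWithCorners ℝ (EuclideanSpace ℝ (Fin 3)) H)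
    {Y : Type*} [TopologicalSpace Y] [ChartedSpace H Y] [IsManifold J ∞ Y] [T2Space Y]
    (o : AmbientSurgery.ManifoldOrientation J Y)
    (ι : Y → W) (hι : IsSmoothEmbedding J I ∞ ι)
    (γ : Circle → Y) (hγ : IsSmoothEmbedding (𝓡 1) J ∞ γ)
    (Δ : ℂ → W) (hΔ : AmbientSurgery.IsSpanningDisk J I ι γ Δ)
    (φ : AmbientSurgery.Framing o γ) :
    (∀ (k : ℤ) (c : AmbientSurgery.FramingClass o γ), k +ᵥ c = c → k = 0) ∧
    (∀ c d : AmbientSurgery.FramingClass o γ, ∃ k : ℤ, k +ᵥ c = d) ∧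
    ((∀ ψ : AmbientSurgery.Framing o γ, AmbientSurgery.Admissible I ι Δ ψ ↔
        ∃ k : ℤ, Even k ∧ ψ.toClass = k +ᵥ φ.toClass) ∨
      (∀ ψ : AmbientSurgery.Framing o γ, AmbientSurgery.Admissible I ι Δ ψ ↔
        ∃ k : ℤ, Odd k ∧ ψ.toClass = k +ᵥ φ.toClass)) :=
  lemma5p3_general I J o γ hγ.contMDiff ι hι.contMDiff
    (fun z => AmbientSurgery.mfderiv_injective_of_isImmersionAt
      (hι.isImmersion.isImmersionAt (γ z)) (by simp)) Δ hΔ.isImmersedSpanningDisk φ
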